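/- **The game $G_{am}(P,A)$.** Let $P_1,P_2$ be continuously differentiable, (weakly) increasing functions on $[0,1]$ with $P_j(0)=0$, $P_j(1)=1$, $P_j(t)<1$ for $t<1$, and let $A_1,A_2\ge 0$, $a>0$, $m\in\mathbb N$, $m\ge1$. Player I has an infinitely divisible resource $a$, Player II has $m$ units. A play consists of a consumption function $\alpha:[0,1]\to[0,\infty)$ of Player I, which is nonincreasing, continuous, piecewise continuously differentiable in $(0,1)$, with $\alpha(0)=a$ ($\alpha(t)$ is the resource remaining at time $t$), and of action moments $0\le\eta_m\le\dots\le\eta_1\le1$ of Player II. Put $\xi=-\alpha'$, and let $n(t)$ be the number of $k\in\{1,\dots,m\}$ with $\eta_k\ge t$. The probability that Player I succeeds on $[t_1,t_2]$ is $\varphi(\alpha,t_1,t_2)=1-\exp\int_{t_1}^{t_2}\xi(\tau)\log(1-P_1(\tau))\,d\tau$ (equal to $1$ if the integral diverges), and Player II's $k$-th action moment gives him success with probability $P_2(\eta_k)$. It is required that a player whose opponent has exhausted his resource uses what he has left so that his success has probability $1$. The payoff to Player I is given recursively by $$K(\alpha;\eta_1,\dots,\eta_m)=A_1\varphi-A_2(1-\varphi)P_2(\eta_m)+(1-P_2(\eta_m))(1-\varphi)K(\alpha_m;\eta_1,\dots,\eta_{m-1}),\qquad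 \varphi=\varphi(\alpha,0,\eta_m),$$ where $\alpha_m(t)=\alpha(\max(t,\eta_m))$, and, for no units of Player II, $K=A_1$ if Player I has a positive resource left and $K=0$ otherwise. A strategy of Player I is a (partial) function $\xi=u(t,\alpha,n)$ giving the intensity at time $t$ for the current resources $\alpha,n$ (followed up to finitely many times); a strategy of Player II is a function $v(\alpha,n)$ giving the moment of his next action for the current resources: it is followed if $t\le v(\alpha(t),n(t))$ and $\eta_k=v(\alpha(\eta_k),k)$. Strategies apply only while $\alpha(t)n(t)>0$. **$T$-plays and $T$-strategies.** Let $\mathcal T$ be the set of sequences $T=(T_1,T_2,\dots)$ of functions $T_k:[0,\infty)\to(0,1]$ that are continuous, continuously differentiable on $(0,\infty)$, and satisfy $T_k(0)=1$, and $T_k'(x)<0$ and $T_{k+1}(x)<T_k(x)$ for $x>0$. A play is a $T$-play if $t\le T_{n(t)}(\alpha(t))$ whenever $\alpha(t)n(t)>0$, with equality at the action moments of both players: $t=T_{n(t)}(\alpha(t))$ at the points $t$ from which $\alpha$ strictly decreases, and $\eta_k=T_k(\alpha(\eta_k))$ for Player II. A $T$-strategy of Player I is $\xi=0$ if $t<T_n(\alpha)$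 and $\xi=-1/T_n'(\alpha)$ if $t=T_n(\alpha)$; a $T$-strategy of Player II is $v(\alpha,n)=T_n(\alpha)$. **Theorem.** Let $T\in\mathcal T$ satisfy $$\exp\Big(\int_0^x\log\big(1-P_1(T_k(s))\big)\,ds\Big)+\prod_{i=1}^k\big(1-P_2(T_i(x))\big)=1\qquad\text{for all }0<x\le a,\ 1\le k\le m.$$ Then all $T$-plays of $G_{am}(P,A)$ have the same payoff $$v_m(a)=A_1-(A_1+A_2)\exp\Big(\int_0^a\log\big(1-P_1(T_m(s))\big)\,ds\Big)=(A_1+A_2)\prod_{i=1}^m\big(1-P_2(T_i(a))\big)-A_2 ,$$ and any pair of $T$-strategies is a saddle point of $G_{am}(P,A)$, with value $v_m(a)$. That is: each of the two strategies can be played against every behaviour of the opponent; there is a play in which both are followed; every play in which both are followed has payoff $v_m(a)$; every play in which Player I follows his $T$-strategy has payoff at least $v_m(a)$; and every play in which Player II follows his $T$-strategy has payoff at most $v_m(a)$. -/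

import Mathlib

open Set Filter Topology MeasureTheory

noncomputable section

/-- An effectiveness function: continuously differentiable and (weakly) increasing on `[0,1]`,
`P(0) = 0`, `P(1) = 1` and `P(t) < 1` for `t < 1`. -/
structure IsEffectiveness (P : ℝ → ℝ) : Prop where
  contDiffOn : ContDiffOn ℝ 1 P (Icc 0 1)
  monotoneOn : MonotoneOn P (Icc 0 1)
  map_zero : P 0 = 0
  map_one : P 1 = 1
  lt_one : ∀ t ∈ Ico (0 : ℝ) 1, P t < 1

/-- The data `(P, A)` of a noisy fighter-bomber duel: the effectiveness functions
and the profits of the two players. -/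
structure NoisyDuel where
  P₁ : ℝ → ℝ
  P₂ : ℝ → ℝ
  A₁ : ℝ
  A₂ : ℝ
  hP₁ : IsEffectiveness P₁
  hP₂ : IsEffectiveness P₂
  hA₁ : 0 ≤ A₁
  hA₂ : 0 ≤ A₂

/-- The intensity function `ξ = -α'` of a consumption function `α`. -/
def intensity (α : ℝ → ℝ) (t : ℝ) : ℝ := -deriv α t

/-- Piecewise continuously differentiable in `(0,1)`: outside a finite set the derivative exists and
is continuous, and at the points of that set in `(0,1)` it has finite one-sided limits.
Nothing is required at the end points `0` and `1`. -/
def PiecewiseC1 (α : ℝ → ℝ) : Prop :=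
  ∃ S : Finset ℝ,
    (∀ t ∈ Ioo (0 : ℝ) 1, t ∉ S → DifferentiableAt ℝ α t ∧ ContinuousAt (deriv α) t) ∧
    (∀ s ∈ S, s ∈ Ioo (0 : ℝ) 1 →
      (∃ l, Tendsto (deriv α) (𝓝[<] s) (𝓝 l)) ∧ (∃ r, Tendsto (deriv α) (𝓝[>] s) (𝓝 r)))

/-- Consumption functions of Player I with initial resource `a`; `α t` is the remaining resource. -/
structure IsConsumption (a : ℝ) (α : ℝ → ℝ) : Prop where
  continuousOn : ContinuousOn α (Icc 0 1)
  piecewiseC1 : PiecewiseC1 α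
  antitoneOn : AntitoneOn α (Icc 0 1)
  start : α 0 = a
  nonneg : ∀ t ∈ Icc (0 : ℝ) 1, 0 ≤ α t

/-- Vectors of action moments of Player II, `0 ≤ η_m ≤ … ≤ η_1 ≤ 1`. Only the values `η k` with
`1 ≤ k ≤ m` matter; `η k` is the moment at which Player II goes from `k` units to `k - 1`. -/
structure IsActionVector (m : ℕ) (η : ℕ → ℝ) : Prop where
  mem : ∀ k, 1 ≤ k → k ≤ m → η k ∈ Icc (0 : ℝ) 1
  anti : ∀ k, 1 ≤ k → k + 1 ≤ m → η (k + 1) ≤ η k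

/-- The consumption function `n(t)` of Player II (continuous from the left): the number of units
that are not used before the moment `t`. -/
def remaining (m : ℕ) (η : ℕ → ℝ) (t : ℝ) : ℕ :=
  ((Finset.Icc 1 m).filter (fun k => t ≤ η k)).card

/-- The consumption function `α_m` that is constantly `α(s)` before `s` and `α` from `s` on. -/
def restartAt (α : ℝ → ℝ) (s : ℝ) : ℝ → ℝ := fun t => if t < s then α s else α t

/-- Feedback strategies of Player I: the intensity `ξ = u(t, α, n)`, a partial function of
the time and of the current resources. -/
abbrev StrategyI := ℝ × ℝ × ℕ →. ℝ

/-- Feedback strategies of Player II: the moment `v(α, n)` of the next action, as a function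
of the current resources. -/
abbrev StrategyII := ℝ → ℕ → ℝ

/-- In the play `(α, η)` Player I acts according to `u`: while `α(t) n(t) > 0`, the intensity at `t`
is the one prescribed by `u` (in particular `u` is defined there), except for finitely many `t`. -/
def FollowsI (m : ℕ) (u : StrategyI) (α : ℝ → ℝ) (η : ℕ → ℝ) : Prop :=
  ∀ᶠ t in cofinite, t ∈ Ioo (0 : ℝ) 1 → 0 < α t → 0 < remaining m η t →
    DifferentiableAt ℝ α t ∧ intensity α t ∈ u (t, α t, remaining m η t)

/-- In the play `(α, η)` Player II acts according to `v`: while `α(t) n(t) > 0`, the currently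
prescribed moment of the next action is never in the past, and each action takes place at
the prescribed moment. -/
def FollowsII (m : ℕ) (v : StrategyII) (α : ℝ → ℝ) (η : ℕ → ℝ) : Prop :=
  (∀ t ∈ Icc (0 : ℝ) 1, 0 < α t → 0 < remaining m η t → t ≤ v (α t) (remaining m η t)) ∧
  (∀ k, 1 ≤ k → k ≤ m → 0 < α (η k) → η k = v (α (η k)) k)

namespace NoisyDuel

variable (D : NoisyDuel)

/-- The integral `-∫_{t₁}^{t₂} ξ(τ) log (1 - P₁(τ)) dτ ∈ [0, ∞]`; it may diverge when `t₂ = 1`. -/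
def hazard (α : ℝ → ℝ) (t₁ t₂ : ℝ) : ENNReal :=
  ∫⁻ τ in Ioo t₁ t₂, ENNReal.ofReal (-(intensity α τ * Real.log (1 - D.P₁ τ)))

/-- The probability `φ(α, t₁, t₂) = 1 - exp ∫_{t₁}^{t₂} ξ(τ) log (1 - P₁(τ)) dτ` of Player I achieving
success on `[t₁, t₂]`; it is `1` if the integral diverges. -/
def successI (α : ℝ → ℝ) (t₁ t₂ : ℝ) : ℝ :=
  open Classical in
  1 - (if D.hazard α t₁ t₂ = ⊤ then 0 else Real.exp (-(D.hazard α t₁ t₂).toReal))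

/-- The payoff function `K(α; η_1, …, η_m)`, by recursion on `m`. -/
def payoff : ℕ → (ℝ → ℝ) → (ℕ → ℝ) → ℝ
  | 0, α, _ => open Classical in if 0 < α 0 then D.A₁ else 0
  | m + 1, α, η =>
      D.A₁ * D.successI α 0 (η (m + 1))
        - D.A₂ * (1 - D.successI α 0 (η (m + 1))) * D.P₂ (η (m + 1))
        + (1 - D.P₂ (η (m + 1))) * (1 - D.successI α 0 (η (m + 1)))
            * payoff m (restartAt α (η (m + 1))) η

/-- Plays of the game with initial resources `a` and `m`. A player whose opponent has exhausted his
resource consumes what he has left in such a way that the probability of his success is `1`. -/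
structure IsPlay (a : ℝ) (m : ℕ) (α : ℝ → ℝ) (η : ℕ → ℝ) : Prop where
  consumption : IsConsumption a α
  actions : IsActionVector m η
  restI : ∀ t ∈ Ico (0 : ℝ) 1, (∀ k, 1 ≤ k → k ≤ m → η k ≤ t) → 0 < α t → D.successI α t 1 = 1
  restII : ∀ t ∈ Icc (0 : ℝ) 1, α t = 0 → 0 < remaining m η t →
    1 - ∏ k ∈ (Finset.Icc 1 m).filter (fun k => t ≤ η k), (1 - D.P₂ (η k)) = 1

/-- `u` can be played against every behaviour of Player II: for each vector `η₀` of action moments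
there is a play in which Player I follows `u` and Player II acts according to `η₀`
as long as Player I has resource left. -/
def IsPlayableI (a : ℝ) (m : ℕ) (u : StrategyI) : Prop :=
  ∀ η₀, IsActionVector m η₀ → ∃ α η, D.IsPlay a m α η ∧ FollowsI m u α η ∧
    ∀ k, 1 ≤ k → k ≤ m → (0 < α (η₀ k) ∨ 0 < α (η k)) → η k = η₀ k

/-- `v` can be played against every behaviour of Player I: for each consumption function `α₀` there
is a play in which Player II follows `v` and Player I consumes according to `α₀` as long as
Player II has resource left. -/
def IsPlayableII (a : ℝ) (m : ℕ) (v : StrategyII) : Prop :=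
  ∀ α₀, IsConsumption a α₀ → ∃ α η, D.IsPlay a m α η ∧ FollowsII m v α η ∧
    ∀ t ∈ Icc (0 : ℝ) 1, 0 < remaining m η t → α t = α₀ t

/-- `(u, v)` is a saddle point of the game with initial resources `a`, `m`, and `V` is the value of
the game: the two strategies can be played, together and against every behaviour of the opponent,
`V` is the payoff when both are used, and no player can improve on `V` by changing his own strategy.
A pair of strategies may admit several plays; the payoff statements hold for all of them. -/
structure IsSaddlePoint (a : ℝ) (m : ℕ) (u : StrategyI) (v : StrategyII) (V : ℝ) : Prop where
  playableI : D.IsPlayableI a m u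
  playableII : D.IsPlayableII a m v
  exists_play : ∃ α η, D.IsPlay a m α η ∧ FollowsI m u α η ∧ FollowsII m v α η
  payoff_eq : ∀ α η, D.IsPlay a m α η → FollowsI m u α η → FollowsII m v α η →
    D.payoff m α η = V
  payoff_le : ∀ (u' : StrategyI) α η, D.IsPlay a m α η → FollowsI m u' α η → FollowsII m v α η →
    D.payoff m α η ≤ V
  le_payoff : ∀ (v' : StrategyII) α η, D.IsPlay a m α η → FollowsI m u α η → FollowsII m v' α η →
    V ≤ D.payoff m α η

end NoisyDuel

/-- The class `𝒯` of sequences `T_1, T_2, …` of functions on `[0, ∞)`; the value `T 0` is not used. -/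
structure IsClassT (T : ℕ → ℝ → ℝ) : Prop where
  continuousOn : ∀ k, 1 ≤ k → ContinuousOn (T k) (Ici 0)
  contDiffOn : ∀ k, 1 ≤ k → ContDiffOn ℝ 1 (T k) (Ioi 0)
  pos : ∀ k, 1 ≤ k → ∀ x, 0 ≤ x → 0 < T k x
  le_one : ∀ k, 1 ≤ k → ∀ x, 0 ≤ x → T k x ≤ 1
  deriv_neg : ∀ k, 1 ≤ k → ∀ x, 0 < x → deriv (T k) x < 0
  succ_lt : ∀ k, 1 ≤ k → ∀ x, 0 < x → T (k + 1) x < T k x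
  map_zero : ∀ k, 1 ≤ k → T k 0 = 1

/-- Action moments of Player I: the decreasing points of his consumption function. -/
def IsActionMomentI (α : ℝ → ℝ) (t : ℝ) : Prop :=
  t ∈ Ico (0 : ℝ) 1 ∧ ∀ s ∈ Ioc t 1, α s < α t

/-- `T`-plays: while `α(t) n(t) > 0` one has `t ≤ T_{n(t)}(α(t))`, with equality at the action moments
of both players. -/
structure IsTPlay (T : ℕ → ℝ → ℝ) (m : ℕ) (α : ℝ → ℝ) (η : ℕ → ℝ) : Prop where
  le : ∀ t ∈ Icc (0 : ℝ) 1, 0 < α t → 0 < remaining m η t → t ≤ T (remaining m η t) (α t)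
  eqI : ∀ t, IsActionMomentI α t → 0 < α t → 0 < remaining m η t → t = T (remaining m η t) (α t)
  eqII : ∀ k, 1 ≤ k → k ≤ m → 0 < α (η k) → η k = T k (α (η k))

/-- `T`-strategies of Player I: for `α n > 0`, the intensity is `0` when `t < T_n(α)`, it is
`-1 / T_n'(α)` when `t = T_n(α)`, and nothing is prescribed when `t > T_n(α)`. -/
def IsTStrategyI (T : ℕ → ℝ → ℝ) (u : StrategyI) : Prop :=
  ∀ t x n, 0 < x → 1 ≤ n → ∀ ξ, ξ ∈ u (t, x, n) ↔
    (t < T n x ∧ ξ = 0) ∨ (t = T n x ∧ ξ = -1 / deriv (T n) x)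

/-- `T`-strategies of Player II: for `α n > 0`, the moment of the next action is `T_n(α)`. -/
def IsTStrategyII (T : ℕ → ℝ → ℝ) (v : StrategyII) : Prop :=
  ∀ x n, 0 < x → 1 ≤ n → v x n = T n x

end

/-!
With `E_k(x) = exp ∫₀ˣ log (1 - P₁(T_k(s))) ds` and `Q_k(x) = ∏_{i ≤ k} (1 - P₂(T_i(x)))`, the
assumption reads `E_k + Q_k = 1`, and the value with resources `x`, `k` is
`(A₁ + A₂) Q_k(x) - A₂ = A₁ - (A₁ + A₂) E_k(x)`. It is reproduced by the payoff recursion: if the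
remaining play starts at `s` with `k` units, the next action of Player II is at `t`, and the
continuation has value `(A₁ + A₂) Q_{k-1}(α(t)) - A₂`, then the payoff is
`A₁ - (A₁ + A₂) (1 - φ(α, s, t)) (1 - (1 - P₂(t)) Q_{k-1}(α(t)))`. Since
`log E_k(α(τ)) = ∫₀^{α(τ)} log (1 - P₁(T_k))`, the chain rule compares `1 - φ(α, s, t)` with
`E_k(α(s)) / E_k(α(t))`:

* if Player II acts on the curves `t = T_k(α)`, then `τ ≤ T_k(α(τ))` throughout, so that the
  resource of Player I is spent no more effectively than on the curve (`IsBalanced.hazard_le`),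
  and the last factor is `1 - Q_k(α(t)) = E_k(α(t))`: the payoff is at most the value
  (`IsBalanced.payoffFrom_le`);
* if Player I spends his resource on the curves only, then `1 - φ ≤ E_k(α(s)) / E_k(α(t))`
  (`IsBalanced.le_hazard`), and `t ≤ T_k(α(t))` bounds the last factor by `E_k(α(t))`: the payoff
  is at least the value (`IsBalanced.le_payoffFrom`).

`T`-plays satisfy both hypotheses. For the existence statements, `exists_isPlay` completes a
consumption function and a vector of action moments to a play by spending what Player I has left
after the last action as `c / (1 - log (1 - P₁))`, which succeeds with certainty. Player I follows
his `T`-strategy by gluing the functions `min(x, T_k⁻¹(t))`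
(`IsClassT.exists_consumption_of_actions`), Player II by acting at the first moments at which the
curves are reached (`IsClassT.exists_actions`).
-/

noncomputable section

/-! ### Effectiveness functions and the class `𝒯` -/

namespace IsEffectiveness

variable {P : ℝ → ℝ} (hP : IsEffectiveness P)
include hP

lemma nonneg {t : ℝ} (ht : t ∈ Icc (0 : ℝ) 1) : 0 ≤ P t :=
  hP.map_zero ▸ hP.monotoneOn (left_mem_Icc.2 zero_le_one) ht ht.1

lemma le_one {t : ℝ} (ht : t ∈ Icc (0 : ℝ) 1) : P t ≤ 1 :=
  hP.map_one ▸ hP.monotoneOn ht (right_mem_Icc.2 zero_le_one) ht.2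

lemma contDiffOn_Ioo : ContDiffOn ℝ 1 P (Ioo 0 1) := hP.contDiffOn.mono Ioo_subset_Icc_self

lemma differentiableAt {t : ℝ} (ht : t ∈ Ioo (0 : ℝ) 1) : DifferentiableAt ℝ P t :=
  (hP.contDiffOn_Ioo.differentiableOn one_ne_zero).differentiableAt (isOpen_Ioo.mem_nhds ht)

lemma continuousAt_deriv {t : ℝ} (ht : t ∈ Ioo (0 : ℝ) 1) : ContinuousAt (deriv P) t :=
  (hP.contDiffOn_Ioo.continuousOn_deriv_of_isOpen isOpen_Ioo le_rfl).continuousAt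
    (isOpen_Ioo.mem_nhds ht)

lemma log_nonpos {t : ℝ} (ht : t ∈ Icc (0 : ℝ) 1) : Real.log (1 - P t) ≤ 0 :=
  Real.log_nonpos (by linarith [hP.le_one ht]) (by linarith [hP.nonneg ht])

lemma log_antitoneOn : AntitoneOn (fun t => Real.log (1 - P t)) (Ico 0 1) := by
  intro s hs t ht hst
  have h1 := hP.lt_one t ht
  have h2 := hP.monotoneOn (Ico_subset_Icc_self hs) (Ico_subset_Icc_self ht) hst
  exact Real.log_le_log (by linarith) (by linarith)

end IsEffectiveness

namespace IsClassT

variable {T : ℕ → ℝ → ℝ} (hT : IsClassT T)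
include hT

lemma strictAntiOn {k : ℕ} (hk : 1 ≤ k) : StrictAntiOn (T k) (Ici 0) :=
  strictAntiOn_of_deriv_neg (convex_Ici 0) (hT.continuousOn k hk) fun x hx =>
    hT.deriv_neg k hk x (by simpa using hx)

lemma lt_one {k : ℕ} (hk : 1 ≤ k) {x : ℝ} (hx : 0 < x) : T k x < 1 := by
  have := hT.strictAntiOn hk self_mem_Ici (mem_Ici.2 hx.le) hx
  rwa [hT.map_zero k hk] at this

lemma mem_Ioo {k : ℕ} (hk : 1 ≤ k) {x : ℝ} (hx : 0 < x) : T k x ∈ Ioo (0 : ℝ) 1 :=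
  ⟨hT.pos k hk x hx.le, hT.lt_one hk hx⟩

lemma mem_Icc {k : ℕ} (hk : 1 ≤ k) {x : ℝ} (hx : 0 ≤ x) : T k x ∈ Icc (0 : ℝ) 1 :=
  ⟨(hT.pos k hk x hx).le, hT.le_one k hk x hx⟩

lemma succ_le {k : ℕ} (hk : 1 ≤ k) {x : ℝ} (hx : 0 ≤ x) : T (k + 1) x ≤ T k x := by
  rcases hx.eq_or_lt with rfl | hx
  · rw [hT.map_zero k hk, hT.map_zero (k + 1) (by omega)]
  · exact (hT.succ_lt k hk x hx).le

lemma contDiffAt {k : ℕ} (hk : 1 ≤ k) {x : ℝ} (hx : 0 < x) : ContDiffAt ℝ 1 (T k) x :=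
  (hT.contDiffOn k hk).contDiffAt (isOpen_Ioi.mem_nhds hx)

lemma hasDerivAt {k : ℕ} (hk : 1 ≤ k) {x : ℝ} (hx : 0 < x) :
    HasDerivAt (T k) (deriv (T k) x) x :=
  ((hT.contDiffAt hk hx).differentiableAt one_ne_zero).hasDerivAt

lemma continuousAt_deriv {k : ℕ} (hk : 1 ≤ k) {x : ℝ} (hx : 0 < x) :
    ContinuousAt (deriv (T k)) x :=
  ((hT.contDiffOn k hk).continuousOn_deriv_of_isOpen isOpen_Ioi le_rfl).continuousAt
    (isOpen_Ioi.mem_nhds hx)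

end IsClassT

/-! ### Consumption functions and action moments -/

lemma PiecewiseC1.exists_finset {α : ℝ → ℝ} (h : PiecewiseC1 α) :
    ∃ S : Finset ℝ, ∀ t ∈ Ioo (0 : ℝ) 1, t ∉ S → DifferentiableAt ℝ α t :=
  let ⟨S, hS, _⟩ := h
  ⟨S, fun t ht hn => (hS t ht hn).1⟩

namespace IsConsumption

variable {a : ℝ} {α : ℝ → ℝ} (hα : IsConsumption a α)
include hα

lemma le_start {t : ℝ} (ht : t ∈ Icc (0 : ℝ) 1) : α t ≤ a :=
  hα.start ▸ hα.antitoneOn (left_mem_Icc.2 zero_le_one) ht ht.1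

lemma deriv_nonpos {t : ℝ} (ht : t ∈ Ioo (0 : ℝ) 1) : deriv α t ≤ 0 := by
  rw [← derivWithin_of_mem_nhds (Icc_mem_nhds ht.1 ht.2)]
  exact hα.antitoneOn.derivWithin_nonpos

lemma eq_zero_of_le {s t : ℝ} (hs : s ∈ Icc (0 : ℝ) 1) (ht : t ∈ Icc (0 : ℝ) 1) (hst : s ≤ t)
    (h : α s = 0) : α t = 0 :=
  le_antisymm (h ▸ hα.antitoneOn hs ht hst) (hα.nonneg t ht)

/-- The first moment at which the resource is exhausted. -/
lemma exists_first_zero {s t : ℝ} (hs : 0 ≤ s) (ht : t ≤ 1) (hst : s ≤ t) (h0 : 0 < α s)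
    (h1 : α t = 0) : ∃ r ∈ Ioc s t, α r = 0 ∧ ∀ τ ∈ Ico s r, 0 < α τ := by
  have hsub : Icc s t ⊆ Icc (0 : ℝ) 1 := Icc_subset_Icc hs ht
  have hc : IsCompact (Icc s t ∩ α ⁻¹' {0}) := by
    refine isCompact_Icc.of_isClosed_subset ?_ inter_subset_left
    exact (hα.continuousOn.mono hsub).preimage_isClosed_of_isClosed isClosed_Icc
      isClosed_singleton
  obtain ⟨r, hr, hmin⟩ := hc.exists_isLeast ⟨t, ⟨hst, le_rfl⟩, h1⟩
  have hr0 : α r = 0 := hr.2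
  refine ⟨r, ⟨lt_of_le_of_ne hr.1.1 ?_, hr.1.2⟩, hr0, fun τ hτ => ?_⟩
  · rintro rfl
    exact h0.ne' hr0
  · have hτm : τ ∈ Icc s t := ⟨hτ.1, hτ.2.le.trans hr.1.2⟩
    refine lt_of_le_of_ne (hα.nonneg τ (hsub hτm)) fun h => ?_
    exact absurd (hmin ⟨hτm, h.symm⟩) (not_le.2 hτ.2)

end IsConsumption

lemma remaining_le (m : ℕ) (η : ℕ → ℝ) (t : ℝ) : remaining m η t ≤ m := by
  simpa [remaining] using Finset.card_filter_le (Finset.Icc 1 m) (fun k => t ≤ η k)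

namespace IsActionVector

variable {m : ℕ} {η : ℕ → ℝ} (hη : IsActionVector m η)
include hη

lemma antitone {i j : ℕ} (hi : 1 ≤ i) (hij : i ≤ j) (hj : j ≤ m) : η j ≤ η i := by
  induction j, hij using Nat.le_induction with
  | base => exact le_rfl
  | succ j hij ih => exact (hη.anti j (by omega) hj).trans (ih (by omega))

/-- The units not used before `t` are those numbered `1, …, n(t)`. -/
lemma le_iff {k : ℕ} (hk : 1 ≤ k) (hkm : k ≤ m) (t : ℝ) : t ≤ η k ↔ k ≤ remaining m η t := by
  constructor
  · intro h
    have : Finset.Icc 1 k ⊆ (Finset.Icc 1 m).filter (fun k => t ≤ η k) := by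
      intro i hi
      rw [Finset.mem_Icc] at hi
      rw [Finset.mem_filter, Finset.mem_Icc]
      exact ⟨⟨hi.1, hi.2.trans hkm⟩, h.trans (hη.antitone hi.1 hi.2 hkm)⟩
    simpa [remaining] using Finset.card_le_card this
  · intro h
    by_contra hlt
    have : (Finset.Icc 1 m).filter (fun k => t ≤ η k) ⊆ Finset.Icc 1 (k - 1) := by
      intro i hi
      rw [Finset.mem_filter, Finset.mem_Icc] at hi
      rw [Finset.mem_Icc]
      refine ⟨hi.1.1, ?_⟩
      by_contra hik
      exact hlt (hi.2.trans (hη.antitone hk (by omega) hi.1.2))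
    have := Finset.card_le_card this
    simp only [Nat.card_Icc] at this
    unfold remaining at h
    omega

lemma remaining_eq {k : ℕ} (hkm : k ≤ m) {t : ℝ} (h1 : 1 ≤ k → t ≤ η k)
    (h2 : k + 1 ≤ m → η (k + 1) < t) : remaining m η t = k := by
  apply le_antisymm
  · by_contra! h
    have hm := remaining_le m η t
    have := (hη.le_iff (k := k + 1) (by omega) (by omega) t).2 h
    linarith [h2 (by omega)]
  · rcases Nat.eq_zero_or_pos k with rfl | hk
    · exact Nat.zero_le _
    · exact (hη.le_iff hk hkm t).1 (h1 hk)

end IsActionVector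

/-! ### The hazard integral -/

/-- The fundamental theorem of calculus for a monotone function, in terms of the lower Lebesgue
integral. Monotonicity supplies the integrability of the derivative. -/
lemma lintegral_ofReal_deriv_of_monotoneOn {F f : ℝ → ℝ} {s t : ℝ} (hst : s ≤ t) {S : Set ℝ}
    (hS : S.Countable) (hc : ContinuousOn F (Icc s t)) (hm : MonotoneOn F (Icc s t))
    (hd : ∀ τ ∈ Ioo s t, τ ∉ S → HasDerivAt F (f τ) τ) :
    ∫⁻ τ in Ioo s t, ENNReal.ofReal (f τ) = ENNReal.ofReal (F t - F s) := by
  have hae : ∀ᵐ τ : ℝ, τ ∈ Ioo s t → ENNReal.ofReal (f τ) = ENNReal.ofReal (deriv F τ) := by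
    filter_upwards [hS.ae_notMem volume] with τ hτ hτ'
    rw [(hd τ hτ' hτ).deriv]
  rw [setLIntegral_congr_fun_ae measurableSet_Ioo hae]
  have hint : IntervalIntegrable (deriv F) volume s t :=
    MonotoneOn.intervalIntegrable_deriv (by rwa [uIcc_of_le hst])
  have hI : ∫ τ in s..t, deriv F τ = F t - F s := by
    refine integral_eq_of_hasDerivAt_off_countable F (deriv F) hS (by rwa [uIcc_of_le hst]) ?_ hint
    rw [min_eq_left hst, max_eq_right hst]
    intro τ hτ
    have := hd τ hτ.1 hτ.2
    rwa [← this.deriv] at this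
  rw [← hI, intervalIntegral.integral_of_le hst, integral_Ioc_eq_integral_Ioo,
    ofReal_integral_eq_lintegral_ofReal]
  · exact ((intervalIntegrable_iff_integrableOn_Ioo_of_le hst).1 hint)
  · refine (ae_restrict_iff' measurableSet_Ioo).2 (Eventually.of_forall fun τ hτ => ?_)
    rw [← derivWithin_of_mem_nhds (Icc_mem_nhds hτ.1 hτ.2)]
    exact hm.derivWithin_nonneg

namespace NoisyDuel

variable (D : NoisyDuel)

lemma hazard_mono {α : ℝ → ℝ} {s t s' t' : ℝ} (hs : s' ≤ s) (ht : t ≤ t') :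
    D.hazard α s t ≤ D.hazard α s' t' :=
  lintegral_mono_set (Ioo_subset_Ioo hs ht)

lemma hazard_le_add {α : ℝ → ℝ} {s r t : ℝ} (hr : r ∈ Ioc s t) :
    D.hazard α s t ≤ D.hazard α s r + D.hazard α r t := by
  have h : D.hazard α s t
      ≤ ∫⁻ τ in Ioo s r ∪ Ico r t,
        ENNReal.ofReal (-(intensity α τ * Real.log (1 - D.P₁ τ))) :=
    lintegral_mono_set (by rw [Ioo_union_Ico_eq_Ioo hr.1 hr.2])
  refine h.trans ((lintegral_union_le _ _ _).trans (add_le_add le_rfl ?_))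
  rw [hazard, setLIntegral_congr Ioo_ae_eq_Ico]

lemma hazard_congr {α β : ℝ → ℝ} {s t : ℝ} (h : EqOn α β (Ioo s t)) :
    D.hazard α s t = D.hazard β s t := by
  refine setLIntegral_congr_fun measurableSet_Ioo fun τ hτ => ?_
  have : deriv α τ = deriv β τ :=
    (h.eventuallyEq_of_mem (isOpen_Ioo.mem_nhds hτ)).deriv_eq
  simp only [intensity, this]

lemma hazard_eq_zero_of_const {α : ℝ → ℝ} {s t c : ℝ} (h : ∀ τ ∈ Ioo s t, α τ = c) :
    D.hazard α s t = 0 := by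
  rw [D.hazard_congr (β := fun _ => c) h]
  simp [hazard, intensity]

lemma successI_congr {α β : ℝ → ℝ} {s t s' t' : ℝ} (h : D.hazard α s t = D.hazard β s' t') :
    D.successI α s t = D.successI β s' t' := by
  simp only [successI, h]

lemma one_sub_successI_nonneg (α : ℝ → ℝ) (s t : ℝ) : 0 ≤ 1 - D.successI α s t := by
  unfold successI
  split_ifs
  · simp
  · simpa using (Real.exp_pos _).le

lemma one_sub_successI_le {α : ℝ → ℝ} {s t c : ℝ} (h : ENNReal.ofReal c ≤ D.hazard α s t) :
    1 - D.successI α s t ≤ Real.exp (-c) := by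
  unfold successI
  split_ifs with h'
  · simpa using (Real.exp_pos _).le
  · have := (ENNReal.ofReal_le_iff_le_toReal h').1 h
    simpa using this

lemma le_one_sub_successI {α : ℝ → ℝ} {s t c : ℝ} (hc : 0 ≤ c)
    (h : D.hazard α s t ≤ ENNReal.ofReal c) : Real.exp (-c) ≤ 1 - D.successI α s t := by
  unfold successI
  rw [if_neg (ne_top_of_le_ne_top ENNReal.ofReal_ne_top h)]
  have := ENNReal.toReal_le_of_le_ofReal hc h
  simpa using this

/-! ### The payoff in terms of one fixed consumption function -/

/-- The payoff of the play that starts at the moment `s`, when Player II has `k` units left: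
the same recursion as `payoff`, but with a variable starting moment instead of consumption functions
that are made constant before it. -/
def payoffFrom : ℕ → (ℝ → ℝ) → ℝ → (ℕ → ℝ) → ℝ
  | 0, α, s, _ => open Classical in if 0 < α s then D.A₁ else 0
  | k + 1, α, s, η =>
      D.A₁ * D.successI α s (η (k + 1))
        - D.A₂ * (1 - D.successI α s (η (k + 1))) * D.P₂ (η (k + 1))
        + (1 - D.P₂ (η (k + 1))) * (1 - D.successI α s (η (k + 1)))
            * payoffFrom k α (η (k + 1)) η

lemma hazard_restartAt (α : ℝ → ℝ) {s r : ℝ} (hs : 0 ≤ s) (hsr : s ≤ r) :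
    D.hazard (restartAt α s) 0 r = D.hazard α s r := by
  have hright : D.hazard (restartAt α s) s r = D.hazard α s r :=
    D.hazard_congr fun τ hτ => if_neg (not_lt.2 hτ.1.le)
  refine le_antisymm ?_ (hright ▸ D.hazard_mono hs le_rfl)
  rcases hs.eq_or_lt with rfl | hs
  · exact hright.le
  have hleft : D.hazard (restartAt α s) 0 s = 0 :=
    D.hazard_eq_zero_of_const (c := α s) fun τ hτ => if_pos hτ.2
  have := D.hazard_le_add (α := restartAt α s) (s := 0) (r := s) (t := r) ⟨hs, hsr⟩
  rwa [hleft, hright, zero_add] at this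

lemma restartAt_restartAt (α : ℝ → ℝ) {s r : ℝ} (hsr : s ≤ r) :
    restartAt (restartAt α s) r = restartAt α r := by
  funext t
  by_cases h : t < r
  · simp [restartAt, h, not_lt.2 hsr]
  · simp [restartAt, h, not_lt.2 (hsr.trans (not_lt.1 h))]

lemma payoff_restartAt (α : ℝ → ℝ) {η : ℕ → ℝ} : ∀ {k : ℕ} {s : ℝ}, IsActionVector k η → 0 ≤ s →
    (1 ≤ k → s ≤ η k) → D.payoff k (restartAt α s) η = D.payoffFrom k α s η
  | 0, s, _, hs, _ => by
    have : restartAt α s 0 = α s := by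
      rcases hs.eq_or_lt with rfl | hs
      · simp [restartAt]
      · simp [restartAt, hs]
    simp [payoff, payoffFrom, this]
  | k + 1, s, hη, hs, hsη => by
    have hsr := hsη (by omega)
    rw [payoff, payoffFrom, restartAt_restartAt α hsr,
      D.successI_congr (D.hazard_restartAt α hs hsr),
      payoff_restartAt α ⟨fun i h1 h2 => hη.mem i h1 (by omega),
        fun i h1 h2 => hη.anti i h1 (by omega)⟩ (hs.trans hsr) fun h => hη.anti k h le_rfl]

lemma payoff_eq_payoffFrom (α : ℝ → ℝ) {η : ℕ → ℝ} {m : ℕ} (hm : 1 ≤ m)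
    (hη : IsActionVector m η) : D.payoff m α η = D.payoffFrom m α 0 η := by
  obtain ⟨k, rfl⟩ : ∃ k, m = k + 1 := ⟨m - 1, by omega⟩
  rw [payoff, payoffFrom, payoff_restartAt D α ⟨fun i h1 h2 => hη.mem i h1 (by omega),
        fun i h1 h2 => hη.anti i h1 (by omega)⟩ (hη.mem _ hm le_rfl).1
        fun h => hη.anti k h le_rfl]

end NoisyDuel

namespace NoisyDuel

/-! ### The balance equation -/

/-- The logarithm of the probability that Player I fails if he spends the resource `x`
along the curve `t = T_k(α)`. -/
def logFailI (D : NoisyDuel) (T : ℕ → ℝ → ℝ) (k : ℕ) (x : ℝ) : ℝ :=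
  ∫ s in (0 : ℝ)..x, Real.log (1 - D.P₁ (T k s))

/-- The probability that Player II fails if he uses the units `k, …, 1` at the moments
`T_k(x), …, T_1(x)`. -/
def failII (D : NoisyDuel) (T : ℕ → ℝ → ℝ) (k : ℕ) (x : ℝ) : ℝ :=
  ∏ i ∈ Finset.Icc 1 k, (1 - D.P₂ (T i x))

/-- The sequence `T ∈ 𝒯` solves the equation of the theorem: the failure probabilities of the two
players along `T` add up to `1`. -/
structure IsBalanced (D : NoisyDuel) (T : ℕ → ℝ → ℝ) (a : ℝ) (m : ℕ) : Prop where
  classT : IsClassT T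
  add_eq_one : ∀ x k, 0 < x → x ≤ a → 1 ≤ k → k ≤ m →
    Real.exp (D.logFailI T k x) + D.failII T k x = 1

section

variable {D : NoisyDuel} {T : ℕ → ℝ → ℝ} {a : ℝ} {m : ℕ}

lemma failII_zero (x : ℝ) : D.failII T 0 x = 1 := by simp [failII]

lemma failII_succ (k : ℕ) (x : ℝ) :
    D.failII T (k + 1) x = D.failII T k x * (1 - D.P₂ (T (k + 1) x)) :=
  Finset.prod_Icc_succ_top (by omega) _

lemma logFailI_zero (k : ℕ) : D.logFailI T k 0 = 0 := by simp [logFailI]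

lemma failII_at_zero (hT : IsClassT T) {k : ℕ} (hk : 1 ≤ k) : D.failII T k 0 = 0 :=
  Finset.prod_eq_zero (Finset.mem_Icc.2 ⟨le_rfl, hk⟩)
    (by rw [hT.map_zero 1 le_rfl, D.hP₂.map_one, sub_self])

lemma failII_pos (hT : IsClassT T) (k : ℕ) {x : ℝ} (hx : 0 < x) : 0 < D.failII T k x :=
  Finset.prod_pos fun i hi => by
    have h := hT.mem_Ioo (Finset.mem_Icc.1 hi).1 hx
    have := D.hP₂.lt_one _ ⟨h.1.le, h.2⟩
    linarith

lemma failII_le_one (hT : IsClassT T) (k : ℕ) {x : ℝ} (hx : 0 ≤ x) : D.failII T k x ≤ 1 :=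
  Finset.prod_le_one
    (fun _ hi => sub_nonneg.2 (D.hP₂.le_one (hT.mem_Icc (Finset.mem_Icc.1 hi).1 hx)))
    (fun _ hi => by linarith [D.hP₂.nonneg (hT.mem_Icc (Finset.mem_Icc.1 hi).1 hx)])

lemma failII_nonneg (hT : IsClassT T) (k : ℕ) {x : ℝ} (hx : 0 ≤ x) : 0 ≤ D.failII T k x :=
  Finset.prod_nonneg
    (fun _ hi => sub_nonneg.2 (D.hP₂.le_one (hT.mem_Icc (Finset.mem_Icc.1 hi).1 hx)))

lemma continuousAt_log (hT : IsClassT T) {k : ℕ} (hk : 1 ≤ k) {x : ℝ} (hx : 0 < x) :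
    ContinuousAt (fun s => Real.log (1 - D.P₁ (T k s))) x := by
  have h := hT.mem_Ioo hk hx
  have h1 : ContinuousAt (fun s => D.P₁ (T k s)) x :=
    ContinuousAt.comp (D.hP₁.differentiableAt h).continuousAt (hT.hasDerivAt hk hx).continuousAt
  have := D.hP₁.lt_one _ ⟨h.1.le, h.2⟩
  exact (continuousAt_const.sub h1).log (sub_pos.2 this).ne'

namespace IsBalanced

variable (hB : D.IsBalanced T a m)
include hB

lemma exp_add_failII {k : ℕ} (hk : 1 ≤ k) (hkm : k ≤ m) {x : ℝ} (hx : 0 ≤ x) (hxa : x ≤ a) :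
    Real.exp (D.logFailI T k x) + D.failII T k x = 1 := by
  rcases hx.eq_or_lt with rfl | hx
  · rw [logFailI_zero, failII_at_zero hB.classT hk]; simp
  · exact hB.add_eq_one x k hx hxa hk hkm

/-- The balance equation forces the integral to converge: otherwise its conventional value `0`
would make the product vanish. -/
lemma intervalIntegrable (ha : 0 < a) {k : ℕ} (hk : 1 ≤ k) (hkm : k ≤ m) :
    IntervalIntegrable (fun s => Real.log (1 - D.P₁ (T k s))) volume 0 a := by
  by_contra h
  have h1 := hB.add_eq_one a k ha le_rfl hk hkm
  rw [logFailI, intervalIntegral.integral_undef h, Real.exp_zero] at h1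
  linarith [failII_pos (D := D) hB.classT k ha]

lemma intervalIntegrable_of_le {k : ℕ} (hk : 1 ≤ k) (hkm : k ≤ m) {x : ℝ} (hx : 0 < x)
    (hxa : x ≤ a) : IntervalIntegrable (fun s => Real.log (1 - D.P₁ (T k s))) volume 0 x := by
  refine (hB.intervalIntegrable (hx.trans_le hxa) hk hkm).mono_set ?_
  rw [uIcc_of_le hx.le, uIcc_of_le (hx.le.trans hxa)]
  exact Icc_subset_Icc_right hxa

lemma continuousOn_logFailI (ha : 0 < a) {k : ℕ} (hk : 1 ≤ k) (hkm : k ≤ m) :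
    ContinuousOn (D.logFailI T k) (Icc 0 a) := by
  rw [← uIcc_of_le ha.le]
  apply intervalIntegral.continuousOn_primitive_interval
  rw [uIcc_of_le ha.le, integrableOn_Icc_iff_integrableOn_Ioc]
  exact (intervalIntegrable_iff_integrableOn_Ioc_of_le ha.le).1 (hB.intervalIntegrable ha hk hkm)

lemma hasDerivAt_logFailI {k : ℕ} (hk : 1 ≤ k) (hkm : k ≤ m) {x : ℝ} (hx : 0 < x) (hxa : x ≤ a) :
    HasDerivAt (D.logFailI T k) (Real.log (1 - D.P₁ (T k x))) x := by
  refine intervalIntegral.integral_hasDerivAt_right (hB.intervalIntegrable_of_le hk hkm hx hxa) ?_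
    (continuousAt_log hB.classT hk hx)
  exact ContinuousOn.stronglyMeasurableAtFilter isOpen_Ioi (fun y hy =>
    (continuousAt_log hB.classT hk hy).continuousWithinAt) x hx

lemma antitoneOn_logFailI (ha : 0 < a) {k : ℕ} (hk : 1 ≤ k) (hkm : k ≤ m) :
    AntitoneOn (D.logFailI T k) (Icc 0 a) := by
  refine antitoneOn_of_deriv_nonpos (convex_Icc 0 a) (hB.continuousOn_logFailI ha hk hkm) ?_ ?_ <;>
    intro x hx <;> rw [interior_Icc] at hx <;>
    have h := hB.hasDerivAt_logFailI hk hkm hx.1 hx.2.le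
  · exact h.differentiableAt.differentiableWithinAt
  · rw [h.deriv]
    exact D.hP₁.log_nonpos (hB.classT.mem_Icc hk hx.1.le)

/-! ### Comparison of the hazard with the curve `t = T_k(α)` -/

variable {α : ℝ → ℝ} (hα : IsConsumption a α)
include hα

/-- Along a consumption function, `logFailI` decreases in the resource; this is its increase,
written with the chain rule. -/
lemma lintegral_log_mul_deriv (ha : 0 < a) {k : ℕ} (hk : 1 ≤ k) (hkm : k ≤ m) {s t : ℝ}
    (hs : 0 ≤ s) (hst : s ≤ t) (ht : t ≤ 1) (hpos : ∀ τ ∈ Ico s t, 0 < α τ) :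
    ∫⁻ τ in Ioo s t, ENNReal.ofReal (Real.log (1 - D.P₁ (T k (α τ))) * deriv α τ)
      = ENNReal.ofReal (D.logFailI T k (α t) - D.logFailI T k (α s)) := by
  have hsub : Icc s t ⊆ Icc (0 : ℝ) 1 := Icc_subset_Icc hs ht
  have hmaps : MapsTo α (Icc s t) (Icc 0 a) := fun τ hτ =>
    ⟨hα.nonneg τ (hsub hτ), hα.le_start (hsub hτ)⟩
  obtain ⟨S, hS⟩ := hα.piecewiseC1.exists_finset
  refine lintegral_ofReal_deriv_of_monotoneOn (F := fun τ => D.logFailI T k (α τ)) hst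
    S.countable_toSet ((hB.continuousOn_logFailI ha hk hkm).comp
      (hα.continuousOn.mono hsub) hmaps) ?_ ?_
  · intro x hx y hy hxy
    exact hB.antitoneOn_logFailI ha hk hkm (hmaps hy) (hmaps hx)
      (hα.antitoneOn (hsub hx) (hsub hy) hxy)
  · intro τ hτ hτS
    have hτ' : τ ∈ Icc s t := Ioo_subset_Icc_self hτ
    exact (hB.hasDerivAt_logFailI hk hkm (hpos τ (Ioo_subset_Ico_self hτ)) (hmaps hτ').2).comp τ
      (hS τ (Ioo_subset_Ioo hs ht hτ) hτS).hasDerivAt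

/-- If Player II never lets the curve `t = T_k(α)` pass, Player I spends his resource at moments
at which it is at most as effective as on the curve. -/
lemma hazard_le (ha : 0 < a) {k : ℕ} (hk : 1 ≤ k) (hkm : k ≤ m) {s t : ℝ}
    (hs : 0 ≤ s) (hst : s ≤ t) (ht : t ≤ 1) (hle : ∀ τ ∈ Ioo s t, 0 < α τ → τ ≤ T k (α τ)) :
    D.hazard α s t ≤ ENNReal.ofReal (D.logFailI T k (α t) - D.logFailI T k (α s)) := by
  have key : ∀ r ≤ t, s ≤ r → (∀ τ ∈ Ico s r, 0 < α τ) →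
      D.hazard α s r ≤ ENNReal.ofReal (D.logFailI T k (α r) - D.logFailI T k (α s)) := by
    intro r hrt hsr hpos
    rw [← hB.lintegral_log_mul_deriv hα ha hk hkm hs hsr (hrt.trans ht) hpos]
    refine setLIntegral_mono' measurableSet_Ioo fun τ hτ => ENNReal.ofReal_le_ofReal ?_
    have hp := hpos τ (Ioo_subset_Ico_self hτ)
    have hτt : τ ∈ Ioo s t := ⟨hτ.1, hτ.2.trans_le hrt⟩
    have hτ1 : τ ∈ Ioo (0 : ℝ) 1 := Ioo_subset_Ioo hs ht hτt
    have hT := hB.classT.mem_Ioo hk hp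
    have hlog := D.hP₁.log_antitoneOn (Ioo_subset_Ico_self hτ1) (Ioo_subset_Ico_self hT)
      (hle τ hτt hp)
    have := mul_le_mul_of_nonpos_right hlog (hα.deriv_nonpos hτ1)
    unfold intensity
    linarith
  have hs1 : s ∈ Icc (0 : ℝ) 1 := ⟨hs, hst.trans ht⟩
  have ht1 : t ∈ Icc (0 : ℝ) 1 := ⟨hs.trans hst, ht⟩
  have hconst : ∀ r ∈ Icc (0 : ℝ) 1, α r = 0 → D.hazard α r t = 0 := fun r hr h =>
    D.hazard_eq_zero_of_const fun τ hτ =>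
      hα.eq_zero_of_le hr ⟨hr.1.trans hτ.1.le, hτ.2.le.trans ht⟩ hτ.1.le h
  rcases (hα.nonneg s hs1).eq_or_lt with h0 | h0
  · rw [hconst s hs1 h0.symm]; exact zero_le
  rcases (hα.nonneg t ht1).eq_or_lt with h1 | h1
  · obtain ⟨r, hr, hr0, hpos⟩ := hα.exists_first_zero hs ht hst h0 h1.symm
    have := key r hr.2 hr.1.le hpos
    rw [hr0, h1] at this
    refine (D.hazard_le_add hr).trans ?_
    rwa [hconst r ⟨hs.trans hr.1.le, hr.2.trans ht⟩ hr0, add_zero]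
  · exact key t le_rfl hst fun τ hτ => h1.trans_le
      (hα.antitoneOn ⟨hs.trans hτ.1, hτ.2.le.trans ht⟩ ht1 hτ.2.le)

/-- If Player I spends his resource only on the curve `t = T_k(α)`, the hazard is at least the
one on the curve. -/
lemma le_hazard (ha : 0 < a) {k : ℕ} (hk : 1 ≤ k) (hkm : k ≤ m) {s t : ℝ}
    (hs : 0 ≤ s) (hst : s ≤ t) (ht : t ≤ 1)
    (heq : ∀ᶠ τ in cofinite, τ ∈ Ioo s t → 0 < α τ → deriv α τ = 0 ∨ τ = T k (α τ)) :
    ENNReal.ofReal (D.logFailI T k (α t) - D.logFailI T k (α s)) ≤ D.hazard α s t := by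
  have key : ∀ r ≤ t, s ≤ r → (∀ τ ∈ Ico s r, 0 < α τ) →
      ENNReal.ofReal (D.logFailI T k (α r) - D.logFailI T k (α s)) ≤ D.hazard α s r := by
    intro r hrt hsr hpos
    rw [← hB.lintegral_log_mul_deriv hα ha hk hkm hs hsr (hrt.trans ht) hpos]
    refine le_of_eq (setLIntegral_congr_fun_ae measurableSet_Ioo ?_)
    have hae := (eventually_cofinite.1 heq).countable.ae_notMem volume
    filter_upwards [hae] with τ hτ hτr
    rcases not_not.1 hτ ⟨hτr.1, hτr.2.trans_le hrt⟩ (hpos τ (Ioo_subset_Ico_self hτr)) with h | h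
    · simp [intensity, h]
    · rw [← h, intensity]
      congr 1
      ring
  have hs1 : s ∈ Icc (0 : ℝ) 1 := ⟨hs, hst.trans ht⟩
  have ht1 : t ∈ Icc (0 : ℝ) 1 := ⟨hs.trans hst, ht⟩
  rcases (hα.nonneg s hs1).eq_or_lt with h0 | h0
  · rw [hα.eq_zero_of_le hs1 ht1 hst h0.symm, ← h0]; simp
  rcases (hα.nonneg t ht1).eq_or_lt with h1 | h1
  · obtain ⟨r, hr, hr0, hpos⟩ := hα.exists_first_zero hs ht hst h0 h1.symm
    have := key r hr.2 hr.1.le hpos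
    rw [hr0, h1] at this
    exact this.trans (D.hazard_mono le_rfl hr.2)
  · exact key t le_rfl hst fun τ hτ => h1.trans_le
      (hα.antitoneOn ⟨hs.trans hτ.1, hτ.2.le.trans ht⟩ ht1 hτ.2.le)

end IsBalanced

/-! ### The two payoff bounds -/

/-- If Player I has exhausted his resource when Player II uses the last unit, then Player II waits
until the moment `1`. -/
lemma IsPlay.P₂_eq_one {α : ℝ → ℝ} {η : ℕ → ℝ} (hp : D.IsPlay a m α η) (hm : 1 ≤ m)
    (h0 : α (η 1) = 0) : D.P₂ (η 1) = 1 := by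
  have hmem := hp.actions.mem 1 le_rfl hm
  have hrem := (hp.actions.le_iff le_rfl hm (η 1)).1 le_rfl
  have h := hp.restII (η 1) hmem h0 hrem
  obtain ⟨k, hk, hk0⟩ := Finset.prod_eq_zero_iff.1 (sub_eq_self.1 h)
  rw [Finset.mem_filter, Finset.mem_Icc] at hk
  have : η k = η 1 := le_antisymm (hp.actions.antitone le_rfl hk.1.1 hk.1.2) hk.2
  rw [this] at hk0
  linarith

/-- Upper bound of the payoff for the part of a play that starts at `s` with `k` units of
Player II, if Player II acts on the curves `t = T_i(α)`. -/
lemma IsBalanced.payoffFrom_le (hB : D.IsBalanced T a m) (ha : 0 < a) {α : ℝ → ℝ} {η : ℕ → ℝ}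
    (hp : D.IsPlay a m α η)
    (hle : ∀ t ∈ Icc (0 : ℝ) 1, 0 < α t → 0 < remaining m η t → t ≤ T (remaining m η t) (α t))
    (heq : ∀ k, 1 ≤ k → k ≤ m → 0 < α (η k) → η k = T k (α (η k))) :
    ∀ (k : ℕ) (s : ℝ), k ≤ m → s ∈ Icc (0 : ℝ) 1 → (1 ≤ k → s ≤ η k) →
      (k + 1 ≤ m → η (k + 1) ≤ s) →
      D.payoffFrom k α s η ≤ (D.A₁ + D.A₂) * D.failII T k (α s) - D.A₂
  | 0, s, _, _, _, _ => by
    have := D.hA₁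
    rw [payoffFrom, failII_zero]
    split_ifs <;> linarith
  | k + 1, s, hkm, hs, hsη, hηs => by
    have hα := hp.consumption
    have ht := hp.actions.mem (k + 1) (by omega) hkm
    have hst := hsη (by omega)
    have ih := payoffFrom_le hB ha hp hle heq k (η (k + 1)) (by omega) ht
      (fun h => hp.actions.anti k h hkm) (fun _ => le_rfl)
    have hαt := hα.nonneg _ ht
    have hαta := hα.le_start ht
    have hP := D.hP₂.le_one ht
    have hbr : Real.exp (D.logFailI T (k + 1) (α (η (k + 1))))
        ≤ 1 - (1 - D.P₂ (η (k + 1))) * D.failII T k (α (η (k + 1))) := by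
      rcases hαt.eq_or_lt with h0 | h0
      · suffices (1 - D.P₂ (η (k + 1))) * D.failII T k (α (η (k + 1))) = 0 by
          rw [this, ← h0, logFailI_zero]; simp
        rcases Nat.eq_zero_or_pos k with rfl | hk
        · rw [hp.P₂_eq_one hkm h0.symm]; simp
        · rw [← h0, failII_at_zero hB.classT hk, mul_zero]
      · have h1 := hB.exp_add_failII (k := k + 1) (by omega) hkm hαt hαta
        rw [failII_succ, ← heq (k + 1) (by omega) hkm h0] at h1
        linarith
    have hmem : ∀ τ ∈ Ioo s (η (k + 1)), 0 < α τ → τ ≤ T (k + 1) (α τ) := by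
      intro τ hτ hpos
      have hn := hp.actions.remaining_eq hkm (fun _ => hτ.2.le)
        (fun h => (hηs h).trans_lt hτ.1)
      have := hle τ ⟨hs.1.trans hτ.1.le, hτ.2.le.trans ht.2⟩ hpos (by omega)
      rwa [hn] at this
    have hS := D.le_one_sub_successI (sub_nonneg.2 (hB.antitoneOn_logFailI ha (by omega) hkm
      ⟨hαt, hαta⟩ ⟨hα.nonneg s hs, hα.le_start hs⟩ (hα.antitoneOn hs ht hst)))
      (hB.hazard_le hα ha (by omega) hkm hs.1 hst ht.2 hmem)
    have hprod := mul_le_mul hS hbr (Real.exp_pos _).le (D.one_sub_successI_nonneg _ _ _)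
    rw [← Real.exp_add, neg_sub, sub_add_cancel] at hprod
    have hE := hB.exp_add_failII (k := k + 1) (by omega) hkm (hα.nonneg s hs) (hα.le_start hs)
    have h1 := mul_le_mul_of_nonneg_left hprod (add_nonneg D.hA₁ D.hA₂)
    have h2 := mul_le_mul_of_nonneg_left ih (mul_nonneg (sub_nonneg.2 hP)
      (D.one_sub_successI_nonneg α s (η (k + 1))))
    rw [payoffFrom]
    linear_combination h1 + h2 - (D.A₁ + D.A₂) * hE

/-- Lower bound of the payoff for the part of a play that starts at `s` with `k` units of
Player II, if Player I spends his resource only on the curves `t = T_i(α)` and never passes them. -/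
lemma IsBalanced.le_payoffFrom (hB : D.IsBalanced T a m) (ha : 0 < a) {α : ℝ → ℝ} {η : ℕ → ℝ}
    (hp : D.IsPlay a m α η)
    (hI : ∀ᶠ t in cofinite, t ∈ Ioo (0 : ℝ) 1 → 0 < α t → 0 < remaining m η t →
      t ≤ T (remaining m η t) (α t) ∧ (deriv α t = 0 ∨ t = T (remaining m η t) (α t))) :
    ∀ (k : ℕ) (s : ℝ), k ≤ m → s ∈ Icc (0 : ℝ) 1 → (1 ≤ k → s ≤ η k) →
      (k + 1 ≤ m → η (k + 1) ≤ s) → (1 ≤ k → s ≤ T k (α s)) → (k = 0 → 0 < α s) →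
      (D.A₁ + D.A₂) * D.failII T k (α s) - D.A₂ ≤ D.payoffFrom k α s η
  | 0, s, _, _, _, _, _, h0 => by
    rw [payoffFrom, failII_zero, if_pos (h0 rfl)]
    linarith
  | k + 1, s, hkm, hs, hsη, hηs, hsT, _ => by
    have hα := hp.consumption
    have ht := hp.actions.mem (k + 1) (by omega) hkm
    have hst := hsη (by omega)
    have hαt := hα.nonneg _ ht
    have hαta := hα.le_start ht
    have hP := D.hP₂.le_one ht
    have hI' : ∀ᶠ τ in cofinite, τ ∈ Ioo s (η (k + 1)) → 0 < α τ →
        τ ≤ T (k + 1) (α τ) ∧ (deriv α τ = 0 ∨ τ = T (k + 1) (α τ)) := by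
      filter_upwards [hI] with τ hτI hτ hpos
      have hn := hp.actions.remaining_eq hkm (fun _ => hτ.2.le)
        (fun h => (hηs h).trans_lt hτ.1)
      have := hτI (Ioo_subset_Ioo hs.1 ht.2 hτ) hpos (by omega)
      rwa [hn] at this
    have htT : η (k + 1) ≤ T (k + 1) (α (η (k + 1))) := by
      rcases hαt.eq_or_lt with h0 | h0
      · rw [← h0, hB.classT.map_zero _ (by omega)]; exact ht.2
      rcases hst.eq_or_lt with h1 | h1
      · rw [← h1]; exact hsT (by omega)
      -- the bound holds at almost all earlier moments, and both sides are left continuous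
      have hsub : Ioo s (η (k + 1)) ⊆ Icc 0 1 := fun τ hτ =>
        ⟨hs.1.trans hτ.1.le, hτ.2.le.trans ht.2⟩
      have hcT := (hB.classT.hasDerivAt (k := k + 1) (by omega) h0).continuousAt
      have hlim : Tendsto (fun τ => T (k + 1) (α τ)) (𝓝[Ioo s (η (k + 1))] (η (k + 1)))
          (𝓝 (T (k + 1) (α (η (k + 1))))) :=
        hcT.tendsto.comp ((hα.continuousOn _ ht).mono hsub)
      rw [nhdsWithin_Ioo_eq_nhdsLT h1] at hlim
      have hid : Tendsto (fun τ : ℝ => τ) (𝓝[<] (η (k + 1))) (𝓝 (η (k + 1))) :=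
        tendsto_id.mono_left nhdsWithin_le_nhds
      refine le_of_tendsto_of_tendsto hid hlim ?_
      have hcof : 𝓝[<] (η (k + 1)) ≤ cofinite := by
        refine le_trans (nhdsWithin_mono _ ?_) (nhdsNE_le_cofinite (η (k + 1)))
        exact fun x hx => ne_of_lt hx
      filter_upwards [hcof hI', Ioo_mem_nhdsLT h1] with τ hτI hτ
      exact (hτI hτ (h0.trans_le (hα.antitoneOn (hsub hτ) ht hτ.2.le))).1
    have hbr : 1 - (1 - D.P₂ (η (k + 1))) * D.failII T k (α (η (k + 1)))
        ≤ Real.exp (D.logFailI T (k + 1) (α (η (k + 1)))) := by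
      have h1 := hB.exp_add_failII (k := k + 1) (by omega) hkm hαt hαta
      rw [failII_succ] at h1
      have h2 := D.hP₂.monotoneOn ht (hB.classT.mem_Icc (k := k + 1) (by omega) hαt) htT
      have h3 := mul_le_mul_of_nonneg_left h2 (failII_nonneg (D := D) hB.classT k hαt)
      linarith
    have hbr0 : 0 ≤ 1 - (1 - D.P₂ (η (k + 1))) * D.failII T k (α (η (k + 1))) :=
      sub_nonneg.2 (mul_le_one₀ (by linarith [D.hP₂.nonneg ht]) (failII_nonneg hB.classT k hαt)
        (failII_le_one hB.classT k hαt))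
    have hS := D.one_sub_successI_le (hB.le_hazard hα ha (k := k + 1) (by omega) hkm hs.1 hst ht.2
      (hI'.mono fun τ h h1 h2 => (h h1 h2).2))
    have hprod := mul_le_mul hS hbr hbr0 (Real.exp_pos _).le
    rw [← Real.exp_add, neg_sub, sub_add_cancel] at hprod
    have hE := hB.exp_add_failII (k := k + 1) (by omega) hkm (hα.nonneg s hs) (hα.le_start hs)
    have h1 := mul_le_mul_of_nonneg_left hprod (add_nonneg D.hA₁ D.hA₂)
    -- the continuation does not matter if the action of Player II succeeds with certainty
    have hJ : (1 - D.P₂ (η (k + 1))) * ((D.A₁ + D.A₂) * D.failII T k (α (η (k + 1))) - D.A₂)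
        ≤ (1 - D.P₂ (η (k + 1))) * D.payoffFrom k α (η (k + 1)) η := by
      by_cases h0 : k = 0 ∧ α (η (k + 1)) = 0
      · obtain ⟨rfl, h0⟩ := h0
        rw [hp.P₂_eq_one hkm h0]; simp
      · refine mul_le_mul_of_nonneg_left (le_payoffFrom hB ha hp hI k (η (k + 1)) (by omega) ht
          (fun h => hp.actions.anti k h hkm) (fun _ => le_rfl)
          (fun h => htT.trans (hB.classT.succ_le h hαt))
          (fun h => lt_of_le_of_ne hαt fun h' => h0 ⟨h, h'.symm⟩)) (sub_nonneg.2 hP)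
    have h2 := mul_le_mul_of_nonneg_left hJ (D.one_sub_successI_nonneg α s (η (k + 1)))
    rw [payoffFrom]
    linear_combination h1 + h2 + (D.A₁ + D.A₂) * hE

lemma IsBalanced.payoff_le (hB : D.IsBalanced T a m) (ha : 0 < a) (hm : 1 ≤ m) {α : ℝ → ℝ}
    {η : ℕ → ℝ} (hp : D.IsPlay a m α η)
    (hle : ∀ t ∈ Icc (0 : ℝ) 1, 0 < α t → 0 < remaining m η t → t ≤ T (remaining m η t) (α t))
    (heq : ∀ k, 1 ≤ k → k ≤ m → 0 < α (η k) → η k = T k (α (η k))) :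
    D.payoff m α η ≤ (D.A₁ + D.A₂) * D.failII T m a - D.A₂ := by
  rw [D.payoff_eq_payoffFrom α hm hp.actions, ← hp.consumption.start]
  exact hB.payoffFrom_le ha hp hle heq m 0 le_rfl (left_mem_Icc.2 zero_le_one)
    (fun _ => (hp.actions.mem m hm le_rfl).1) (by omega)

lemma IsBalanced.le_payoff (hB : D.IsBalanced T a m) (ha : 0 < a) (hm : 1 ≤ m) {α : ℝ → ℝ}
    {η : ℕ → ℝ} (hp : D.IsPlay a m α η)
    (hI : ∀ᶠ t in cofinite, t ∈ Ioo (0 : ℝ) 1 → 0 < α t → 0 < remaining m η t →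
      t ≤ T (remaining m η t) (α t) ∧ (deriv α t = 0 ∨ t = T (remaining m η t) (α t))) :
    (D.A₁ + D.A₂) * D.failII T m a - D.A₂ ≤ D.payoff m α η := by
  have h := hB.le_payoffFrom ha hp hI m 0 le_rfl (left_mem_Icc.2 zero_le_one)
    (fun _ => (hp.actions.mem m hm le_rfl).1) (by omega)
  rw [hp.consumption.start] at h
  rw [D.payoff_eq_payoffFrom α hm hp.actions]
  exact h (fun _ => (hB.classT.pos m hm a ha.le).le) (by omega)

/-- In a `T`-play, Player I spends his resource only on the curves: at a moment of
differentiability that is no action moment, the resource is constant to the right. -/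
lemma _root_.IsTPlay.deriv_eq_zero_or {α : ℝ → ℝ} {η : ℕ → ℝ} (h : IsTPlay T m α η)
    (hα : IsConsumption a α) {t : ℝ} (ht : t ∈ Ioo (0 : ℝ) 1) (hd : DifferentiableAt ℝ α t)
    (h0 : 0 < α t) (hn : 0 < remaining m η t) :
    deriv α t = 0 ∨ t = T (remaining m η t) (α t) := by
  by_cases hact : IsActionMomentI α t
  · exact Or.inr (h.eqI t hact h0 hn)
  · left
    simp only [IsActionMomentI, not_and, not_forall, not_lt] at hact
    obtain ⟨s, hs, hle⟩ := hact ⟨ht.1.le, ht.2⟩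
    have hconst : EqOn α (fun _ => α t) (Icc t s) := by
      intro τ hτ
      have hτ1 : τ ∈ Icc (0 : ℝ) 1 := ⟨ht.1.le.trans hτ.1, hτ.2.trans hs.2⟩
      exact le_antisymm (hα.antitoneOn (Ioo_subset_Icc_self ht) hτ1 hτ.1)
        (hle.trans (hα.antitoneOn hτ1 ⟨ht.1.le.trans hs.1.le, hs.2⟩ hτ.2))
    have hu : UniqueDiffWithinAt ℝ (Icc t s) t := uniqueDiffOn_Icc hs.1 t (left_mem_Icc.2 hs.1.le)
    rw [← hd.derivWithin hu, derivWithin_congr hconst rfl]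
    simp

end
end NoisyDuel

/-! ### Gluing consumption functions -/

/-- The function that is `β` up to the moment `s` and `γ` afterwards. -/
def glueAt (s : ℝ) (β γ : ℝ → ℝ) : ℝ → ℝ := fun t => if t ≤ s then β t else γ t

section glueAt

variable {s t : ℝ} {β γ : ℝ → ℝ}

lemma glueAt_of_le (h : t ≤ s) : glueAt s β γ t = β t := if_pos h

lemma glueAt_of_lt (h : s < t) : glueAt s β γ t = γ t := if_neg (not_le.2 h)

lemma glueAt_of_ge (hs : γ s = β s) (h : s ≤ t) : glueAt s β γ t = γ t := by
  rcases h.eq_or_lt with rfl | h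
  · rw [glueAt_of_le le_rfl, hs]
  · exact glueAt_of_lt h

lemma glueAt_eventuallyEq_left (h : t < s) : glueAt s β γ =ᶠ[𝓝 t] β := by
  filter_upwards [Iio_mem_nhds h] with τ hτ using glueAt_of_le (le_of_lt hτ)

lemma glueAt_eventuallyEq_right (h : s < t) : glueAt s β γ =ᶠ[𝓝 t] γ := by
  filter_upwards [Ioi_mem_nhds h] with τ hτ using glueAt_of_lt hτ

end glueAt

/-- A piecewise continuously differentiable function has one-sided limits of the derivative at every
point, not only at the exceptional ones. -/
lemma PiecewiseC1.exists_tendsto {α : ℝ → ℝ} (h : PiecewiseC1 α) {t : ℝ} (ht : t ∈ Ioo (0 : ℝ) 1) :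
    (∃ l, Tendsto (deriv α) (𝓝[<] t) (𝓝 l)) ∧ (∃ r, Tendsto (deriv α) (𝓝[>] t) (𝓝 r)) := by
  obtain ⟨S, hS, hS'⟩ := h
  by_cases hts : t ∈ S
  · exact hS' t hts ht
  · have := (hS t ht hts).2.tendsto
    exact ⟨⟨_, this.mono_left nhdsWithin_le_nhds⟩, ⟨_, this.mono_left nhdsWithin_le_nhds⟩⟩

lemma PiecewiseC1.glueAt {β γ : ℝ → ℝ} (hβ : PiecewiseC1 β) (hγ : PiecewiseC1 γ) (s : ℝ) :
    PiecewiseC1 (glueAt s β γ) := by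
  have hβ' := fun t ht => hβ.exists_tendsto (t := t) ht
  have hγ' := fun t ht => hγ.exists_tendsto (t := t) ht
  obtain ⟨S₁, hS₁, -⟩ := hβ
  obtain ⟨S₂, hS₂, -⟩ := hγ
  have hleft : ∀ t < s, _root_.deriv (_root_.glueAt s β γ) =ᶠ[𝓝 t] deriv β := fun t h =>
    (glueAt_eventuallyEq_left h).deriv
  have hright : ∀ t > s, _root_.deriv (_root_.glueAt s β γ) =ᶠ[𝓝 t] deriv γ := fun t h =>
    (glueAt_eventuallyEq_right h).deriv
  have hleft' : ∀ t ≤ s, _root_.deriv (_root_.glueAt s β γ) =ᶠ[𝓝[<] t] deriv β := fun t h => by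
    filter_upwards [self_mem_nhdsWithin] with τ hτ
    exact (hleft τ (lt_of_lt_of_le hτ h)).eq_of_nhds
  have hright' : ∀ t ≥ s, _root_.deriv (_root_.glueAt s β γ) =ᶠ[𝓝[>] t] deriv γ := fun t h => by
    filter_upwards [self_mem_nhdsWithin] with τ hτ
    exact (hright τ (lt_of_le_of_lt h hτ)).eq_of_nhds
  refine ⟨insert s (S₁ ∪ S₂), fun t ht htS => ?_, fun t _ ht => ⟨?_, ?_⟩⟩
  · simp only [Finset.mem_insert, Finset.mem_union, not_or] at htS
    rcases lt_or_gt_of_ne htS.1 with h | h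
    · have := hS₁ t ht htS.2.1
      exact ⟨(glueAt_eventuallyEq_left h).differentiableAt_iff.2 this.1,
        (continuousAt_congr (hleft t h)).2 this.2⟩
    · have := hS₂ t ht htS.2.2
      exact ⟨(glueAt_eventuallyEq_right h).differentiableAt_iff.2 this.1,
        (continuousAt_congr (hright t h)).2 this.2⟩
  · rcases le_or_gt t s with h | h
    · obtain ⟨l, hl⟩ := (hβ' t ht).1
      exact ⟨l, hl.congr' (hleft' t h).symm⟩
    · obtain ⟨l, hl⟩ := (hγ' t ht).1
      exact ⟨l, hl.congr' ((hright t h).filter_mono nhdsWithin_le_nhds).symm⟩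
  · rcases lt_or_ge t s with h | h
    · obtain ⟨l, hl⟩ := (hβ' t ht).2
      exact ⟨l, hl.congr' ((hleft t h).filter_mono nhdsWithin_le_nhds).symm⟩
    · obtain ⟨l, hl⟩ := (hγ' t ht).2
      exact ⟨l, hl.congr' (hright' t h).symm⟩

lemma IsConsumption.glueAt {a b s : ℝ} {β γ : ℝ → ℝ} (hβ : IsConsumption a β)
    (hγ : IsConsumption b γ) (hs : s ∈ Icc (0 : ℝ) 1) (h : γ s = β s) :
    IsConsumption a (glueAt s β γ) where
  continuousOn := by
    have h1 : ContinuousOn (_root_.glueAt s β γ) (Icc 0 s) :=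
      (hβ.continuousOn.mono (Icc_subset_Icc_right hs.2)).congr fun t ht => glueAt_of_le ht.2
    have h2 : ContinuousOn (_root_.glueAt s β γ) (Icc s 1) :=
      (hγ.continuousOn.mono (Icc_subset_Icc_left hs.1)).congr fun t ht => glueAt_of_ge h ht.1
    have := h1.union_of_isClosed h2 isClosed_Icc isClosed_Icc
    rwa [Icc_union_Icc_eq_Icc hs.1 hs.2] at this
  piecewiseC1 := hβ.piecewiseC1.glueAt hγ.piecewiseC1 s
  antitoneOn := by
    have h1 : AntitoneOn (_root_.glueAt s β γ) (Icc 0 s) :=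
      (hβ.antitoneOn.mono (Icc_subset_Icc_right hs.2)).congr fun t ht =>
        (glueAt_of_le ht.2).symm
    have h2 : AntitoneOn (_root_.glueAt s β γ) (Icc s 1) :=
      (hγ.antitoneOn.mono (Icc_subset_Icc_left hs.1)).congr fun t ht =>
        (glueAt_of_ge h ht.1).symm
    have := h1.union_right h2 (isGreatest_Icc hs.1) (isLeast_Icc hs.2)
    rwa [Icc_union_Icc_eq_Icc hs.1 hs.2] at this
  start := by rw [glueAt_of_le hs.1, hβ.start]
  nonneg t ht := by
    rcases le_or_gt t s with h' | h'
    · rw [glueAt_of_le h']; exact hβ.nonneg t ht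
    · rw [glueAt_of_lt h']; exact hγ.nonneg t ht

lemma isConsumption_const {a : ℝ} (ha : 0 ≤ a) : IsConsumption a fun _ => a where
  continuousOn := continuousOn_const
  piecewiseC1 := ⟨∅, fun t _ _ => ⟨differentiableAt_const _, by simpa using continuousAt_const⟩,
    fun s hs => absurd hs (Finset.notMem_empty s)⟩
  antitoneOn := antitoneOn_const
  start := rfl
  nonneg _ _ := ha

namespace NoisyDuel

variable (D : NoisyDuel)

/-! ### Spending the resource with certain success -/

/-- A consumption function with certain success on every `[t, 1]`: with `L = -log (1 - P₁)` it is
`c / (1 + L)`, so that the hazard is `c ∫ L / (1 + L)² dL`, which diverges as `L → ∞`. -/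
def certain (c : ℝ) : ℝ → ℝ := fun t => if t < 1 then c / (1 - Real.log (1 - D.P₁ t)) else 0

variable {D} {c t : ℝ}

lemma certain_of_lt (ht : t < 1) : D.certain c t = c / (1 - Real.log (1 - D.P₁ t)) := if_pos ht

lemma one_le_denom (ht : t ∈ Icc (0 : ℝ) 1) : 1 ≤ 1 - Real.log (1 - D.P₁ t) := by
  linarith [D.hP₁.log_nonpos ht]

lemma hasDerivAt_log (ht : t ∈ Ioo (0 : ℝ) 1) :
    HasDerivAt (fun t => Real.log (1 - D.P₁ t)) (-deriv D.P₁ t / (1 - D.P₁ t)) t := by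
  have h1 := (D.hP₁.differentiableAt ht).hasDerivAt.const_sub 1
  exact h1.log (sub_pos.2 (D.hP₁.lt_one t (Ioo_subset_Ico_self ht))).ne'

lemma hasDerivAt_certain (c : ℝ) (ht : t ∈ Ioo (0 : ℝ) 1) :
    HasDerivAt (D.certain c)
      (c * (-deriv D.P₁ t / (1 - D.P₁ t)) / (1 - Real.log (1 - D.P₁ t)) ^ 2) t := by
  have h0 : 1 - Real.log (1 - D.P₁ t) ≠ 0 :=
    (one_pos.trans_le (one_le_denom (Ioo_subset_Icc_self ht))).ne'
  have h := (((hasDerivAt_log (D := D) ht).const_sub 1).inv h0).const_mul c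
  have he : D.certain c =ᶠ[𝓝 t] fun t => c * (1 - Real.log (1 - D.P₁ t))⁻¹ := by
    filter_upwards [Iio_mem_nhds ht.2] with τ hτ
    rw [certain_of_lt hτ, div_eq_mul_inv]
  refine (h.congr_of_eventuallyEq he).congr_deriv ?_
  ring

lemma tendsto_log_atBot :
    Tendsto (fun t => Real.log (1 - D.P₁ t)) (𝓝[Ico 0 1] 1) atBot := by
  refine Real.tendsto_log_nhdsGT_zero.comp (tendsto_nhdsWithin_iff.2 ⟨?_, ?_⟩)
  · have h := (D.hP₁.contDiffOn.continuousOn 1 (right_mem_Icc.2 zero_le_one)).mono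
      Ico_subset_Icc_self
    have := h.tendsto.const_sub 1
    rwa [D.hP₁.map_one, sub_self] at this
  · filter_upwards [self_mem_nhdsWithin] with t ht
    exact sub_pos.2 (D.hP₁.lt_one t ht)

lemma isConsumption_certain (hc : 0 ≤ c) : IsConsumption c (D.certain c) where
  continuousOn := by
    intro t ht
    rcases ht.2.eq_or_lt with rfl | h1
    · have h0 : D.certain c 1 = 0 := if_neg (lt_irrefl _)
      rw [← Ico_insert_right zero_le_one, continuousWithinAt_insert_self, ContinuousWithinAt, h0]
      have h := (tendsto_atTop_add_const_left _ 1
        (tendsto_neg_atBot_atTop.comp (tendsto_log_atBot (D := D)))).const_div_atTop c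
      refine h.congr' ?_
      filter_upwards [self_mem_nhdsWithin] with t ht
      rw [certain_of_lt ht.2]
      rfl
    · have h2 : ContinuousWithinAt (fun t => c / (1 - Real.log (1 - D.P₁ t))) (Icc 0 1) t := by
        have hP := D.hP₁.contDiffOn.continuousOn t ht
        have := sub_pos.2 (D.hP₁.lt_one t ⟨ht.1, h1⟩)
        exact continuousWithinAt_const.div (continuousWithinAt_const.sub
          ((continuousWithinAt_const.sub hP).log this.ne'))
          (one_pos.trans_le (one_le_denom ht)).ne'
      refine h2.congr_of_eventuallyEq ?_ (certain_of_lt h1)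
      filter_upwards [mem_nhdsWithin_of_mem_nhds (Iio_mem_nhds h1)] with τ hτ
      exact certain_of_lt hτ
  piecewiseC1 := by
    refine ⟨∅, fun t ht _ => ⟨(hasDerivAt_certain c ht).differentiableAt, ?_⟩,
      fun s hs => absurd hs (Finset.notMem_empty s)⟩
    have he : deriv (D.certain c) =ᶠ[𝓝 t] fun t =>
        c * (-deriv D.P₁ t / (1 - D.P₁ t)) / (1 - Real.log (1 - D.P₁ t)) ^ 2 := by
      filter_upwards [isOpen_Ioo.mem_nhds ht] with τ hτ
      exact (hasDerivAt_certain c hτ).deriv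
    refine (continuousAt_congr he).2 ?_
    have h1 := sub_pos.2 (D.hP₁.lt_one t (Ioo_subset_Ico_self ht))
    have h2 := one_pos.trans_le (one_le_denom (D := D) (Ioo_subset_Icc_self ht))
    exact (continuousAt_const.mul ((D.hP₁.continuousAt_deriv ht).neg.div
      (continuousAt_const.sub (D.hP₁.differentiableAt ht).continuousAt) h1.ne')).div
      ((continuousAt_const.sub (hasDerivAt_log ht).continuousAt).pow 2) (pow_pos h2 2).ne'
  antitoneOn := by
    intro s hs t ht hst
    rcases ht.2.eq_or_lt with rfl | h1
    · rw [certain, if_neg (lt_irrefl _), certain]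
      split_ifs
      · exact div_nonneg hc (zero_le_one.trans (one_le_denom hs))
      · exact le_rfl
    · rw [certain_of_lt h1, certain_of_lt (hst.trans_lt h1)]
      have := D.hP₁.log_antitoneOn ⟨hs.1, hst.trans_lt h1⟩ ⟨ht.1, h1⟩ hst
      have h2 := one_pos.trans_le (one_le_denom (D := D) hs)
      exact div_le_div_of_nonneg_left hc h2 (by linarith)
  start := by rw [certain_of_lt one_pos, D.hP₁.map_zero]; simp
  nonneg t ht := by
    rw [certain]
    split_ifs
    · exact div_nonneg hc (zero_le_one.trans (one_le_denom ht))
    · exact le_rfl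

lemma hazard_certain (hc : 0 < c) (ht : t ∈ Ico (0 : ℝ) 1) :
    D.hazard (D.certain c) t 1 = ⊤ := by
  -- the antiderivative of the hazard in terms of `y = 1 - log (1 - P₁)`
  set M : ℝ → ℝ := fun y => c * (Real.log y + y⁻¹) with hM
  set y : ℝ → ℝ := fun t => 1 - Real.log (1 - D.P₁ t) with hy
  have hyc : ContinuousOn y (Ico 0 1) := by
    intro τ hτ
    have hP := (D.hP₁.contDiffOn.continuousOn.mono Ico_subset_Icc_self) τ hτ
    exact continuousWithinAt_const.sub
      ((continuousWithinAt_const.sub hP).log (sub_pos.2 (D.hP₁.lt_one τ hτ)).ne')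
  have hy1 : ∀ τ ∈ Icc (0 : ℝ) 1, 1 ≤ y τ := fun τ hτ => one_le_denom hτ
  have hMd : ∀ z, 1 ≤ z → HasDerivAt M (c * (z⁻¹ + -(z ^ 2)⁻¹)) z := fun z hz =>
    ((Real.hasDerivAt_log (by linarith)).add (hasDerivAt_inv (by linarith))).const_mul c
  have hMm : MonotoneOn M (Ici 1) := by
    refine monotoneOn_of_deriv_nonneg (convex_Ici 1)
      (fun z hz => (hMd z hz).continuousAt.continuousWithinAt) (fun z hz =>
        (hMd z (interior_subset hz)).differentiableAt.differentiableWithinAt) fun z hz => ?_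
    have hz1 : 1 ≤ z := interior_subset hz
    rw [(hMd z hz1).deriv]
    have : (z ^ 2)⁻¹ ≤ z⁻¹ := inv_anti₀ (by linarith) (by nlinarith)
    exact mul_nonneg hc.le (by linarith)
  have key : ∀ r ∈ Ioo t 1,
      ENNReal.ofReal (M (y r) - M (y t)) ≤ D.hazard (D.certain c) t 1 := by
    intro r hr
    have hsub : Icc t r ⊆ Ico 0 1 := Icc_subset_Ico ht.1 hr.2
    refine le_trans (le_of_eq (lintegral_ofReal_deriv_of_monotoneOn (F := fun τ => M (y τ))
      hr.1.le countable_empty ?_ ?_ ?_).symm) (D.hazard_mono le_rfl hr.2.le)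
    · refine ContinuousOn.comp (g := M) (t := Ici 1)
        (fun z hz => (hMd z hz).continuousAt.continuousWithinAt) (hyc.mono hsub) fun τ hτ => ?_
      exact hy1 τ (Ico_subset_Icc_self (hsub hτ))
    · intro τ₁ h1 τ₂ h2 h
      refine hMm (hy1 _ (Ico_subset_Icc_self (hsub h1))) (hy1 _ (Ico_subset_Icc_self (hsub h2))) ?_
      have := D.hP₁.log_antitoneOn (hsub h1) (hsub h2) h
      simp only [hy]
      linarith
    · intro τ hτ _
      have hτ1 : τ ∈ Ioo (0 : ℝ) 1 := ⟨ht.1.trans_lt hτ.1, hτ.2.trans hr.2⟩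
      have h1 := hy1 τ (Ioo_subset_Icc_self hτ1)
      have h2 := (hMd _ h1).comp τ ((hasDerivAt_log (D := D) hτ1).const_sub 1)
      refine h2.congr_deriv ?_
      rw [intensity, (hasDerivAt_certain c hτ1).deriv]
      change _ = -(-(_ / (y τ) ^ 2) * _)
      have h3 : Real.log (1 - D.P₁ τ) = 1 - y τ := by simp [hy]
      have h4 : y τ ≠ 0 := by linarith
      rw [h3]
      generalize deriv D.P₁ τ / (1 - D.P₁ τ) = q
      field_simp
      ring
  by_contra htop
  have hbound : ∀ r ∈ Ioo t 1,
      Real.log (y r) ≤ ((D.hazard (D.certain c) t 1).toReal + M (y t)) / c := by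
    intro r hr
    have h1 := (ENNReal.ofReal_le_iff_le_toReal htop).1 (key r hr)
    rw [le_div_iff₀ hc]
    have h2 := hy1 r ⟨ht.1.trans hr.1.le, hr.2.le⟩
    have h3 : 0 ≤ (y r)⁻¹ := by positivity
    have : M (y r) = c * Real.log (y r) + c * (y r)⁻¹ := by simp [hM]; ring
    nlinarith [mul_nonneg hc.le h3]
  have hlim : Tendsto (fun r => Real.log (y r)) (𝓝[Ico 0 1] 1) atTop :=
    Real.tendsto_log_atTop.comp (tendsto_atTop_add_const_left _ 1
      (tendsto_neg_atBot_atTop.comp (tendsto_log_atBot (D := D))))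
  have hlim' := hlim.mono_left (nhdsWithin_mono 1 (Ioo_subset_Ico_self.trans
    (Ico_subset_Ico_left ht.1) : Ioo t 1 ⊆ Ico 0 1))
  rw [nhdsWithin_Ioo_eq_nhdsLT ht.2] at hlim'
  obtain ⟨r, hr1, hr2⟩ := ((hlim'.eventually_gt_atTop _).and (Ioo_mem_nhdsLT ht.2)).exists
  exact absurd (hbound r hr2) (not_le.2 hr1)

/-- A consumption function and a vector of action moments can be turned into a play by changing the
consumption after the last action moment, unless Player I runs out of resource too early. -/
lemma exists_isPlay {a : ℝ} {m : ℕ} (hm : 1 ≤ m) {β : ℝ → ℝ} {η : ℕ → ℝ} (hβ : IsConsumption a β)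
    (hη : IsActionVector m η) (hpos : η 1 < 1 → 0 < β (η 1)) :
    ∃ α, D.IsPlay a m α η ∧ ∀ t ≤ η 1, α t = β t := by
  have hmem := hη.mem 1 le_rfl hm
  have hrem : ∀ t, 0 < remaining m η t → t ≤ η 1 := fun t h => (hη.le_iff le_rfl hm t).2 h
  rcases hmem.2.eq_or_lt with h1 | h1
  · refine ⟨β, ⟨hβ, hη, fun t ht h _ => ?_, fun t ht h0 hn => ?_⟩, fun _ _ => rfl⟩
    · have := h 1 le_rfl hm
      linarith [ht.2]
    · rw [Finset.prod_eq_zero (i := 1), sub_zero]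
      · exact Finset.mem_filter.2 ⟨Finset.mem_Icc.2 ⟨le_rfl, hm⟩, hrem t hn⟩
      · rw [h1, D.hP₂.map_one, sub_self]
  · have hx := hpos h1
    set c : ℝ := β (η 1) * (1 - Real.log (1 - D.P₁ (η 1))) with hc
    have hy := one_pos.trans_le (one_le_denom (D := D) hmem)
    have hc0 : 0 < c := mul_pos hx hy
    have hs : D.certain c (η 1) = β (η 1) := by
      rw [certain_of_lt h1, hc, mul_div_cancel_right₀ _ hy.ne']
    refine ⟨glueAt (η 1) β (D.certain c), ⟨hβ.glueAt (isConsumption_certain hc0.le) hmem hs, hη,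
      fun t ht h _ => ?_, fun t ht h0 hn => ?_⟩, fun t ht => glueAt_of_le ht⟩
    · have ht1 := h 1 le_rfl hm
      have : D.hazard (glueAt (η 1) β (D.certain c)) t 1 = ⊤ := by
        rw [← hazard_certain hc0 ht]
        exact D.hazard_congr fun τ hτ => glueAt_of_lt (ht1.trans_lt hτ.1)
      simp [successI, this]
    · have := hrem t hn
      rw [glueAt_of_le this] at h0
      have := hβ.antitoneOn ht hmem this
      linarith

end NoisyDuel

namespace IsClassT

variable {T : ℕ → ℝ → ℝ} (hT : IsClassT T)
include hT

/-! ### Player I can follow a `T`-strategy -/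

/-- One phase of a play in which Player I follows his `T`-strategy while Player II has `k` units
left: the resource is `x` until the curve `t = T_k(α)` is reached, and `T_k⁻¹(t)` from then on. -/
lemma exists_consumption {k : ℕ} (hk : 1 ≤ k) {x : ℝ} (hx : 0 < x) :
    ∃ γ : ℝ → ℝ, IsConsumption x γ ∧ (∀ t < 1, 0 < γ t) ∧ (∀ t ≤ T k x, γ t = x) ∧
      (∀ t ≤ 1, t ≤ T k (γ t)) ∧
      ∀ t ∈ Ioo (0 : ℝ) 1, t ≠ T k x → DifferentiableAt ℝ γ t ∧
        ((t < T k (γ t) ∧ deriv γ t = 0) ∨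
          (t = T k (γ t) ∧ deriv γ t = (deriv (T k) (γ t))⁻¹)) := by
  have hT1 := hT.mem_Ioo hk hx
  have hanti := hT.strictAntiOn hk
  -- `γ` solves `T_k(γ t) = clamp t`, where `clamp` is the projection onto `[T_k(x), 1]`
  have hclamp : ∀ t : ℝ, ∃ y ∈ Icc 0 x, T k y = max (T k x) (min t 1) := by
    intro t
    have hc : ContinuousOn (T k) (Icc 0 x) := (hT.continuousOn k hk).mono Icc_subset_Ici_self
    have := intermediate_value_Icc' hx.le hc
    rw [hT.map_zero k hk] at this
    exact this ⟨le_max_left _ _, max_le hT1.2.le (min_le_right _ _)⟩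
  choose γ hγ hTγ using hclamp
  have hγ0 : ∀ t, γ t ∈ Ici (0 : ℝ) := fun t => (hγ t).1
  have hinv : ∀ y ∈ Icc 0 x, γ (T k y) = y := by
    intro y hy
    refine hanti.injOn (hγ0 _) hy.1 ?_
    rw [hTγ, min_eq_left (hT.le_one k hk y hy.1), max_eq_right]
    exact hanti.antitoneOn hy.1 hx.le hy.2
  have hmono : Antitone γ := by
    intro s t hst
    refine (hanti.le_iff_ge (hγ0 s) (hγ0 t)).1 ?_
    rw [hTγ, hTγ]
    exact max_le_max le_rfl (min_le_min hst le_rfl)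
  have hcont : Continuous γ := by
    have : Continuous fun t => OrderDual.toDual (⟨γ t, hγ t⟩ : Icc (0 : ℝ) x) :=
      Monotone.continuous_of_surjective (fun s t hst => hmono hst) fun y =>
        ⟨T k (OrderDual.ofDual y).1, congrArg OrderDual.toDual
          (Subtype.ext (hinv _ (OrderDual.ofDual y).2))⟩
    exact continuous_subtype_val.comp (continuous_ofDual.comp this)
  have hpos : ∀ t < 1, 0 < γ t := by
    intro t ht
    refine lt_of_le_of_ne (hγ t).1 fun h => ?_
    have h1 := hTγ t
    rw [← h, hT.map_zero k hk] at h1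
    exact absurd h1.symm (max_lt hT1.2 ((min_le_left _ _).trans_lt ht)).ne
  have hleft : ∀ t ≤ T k x, γ t = x := by
    intro t ht
    refine hanti.injOn (hγ0 _) hx.le ?_
    rw [hTγ, max_eq_left ((min_le_left _ _).trans ht)]
  have hright : ∀ t ∈ Icc (T k x) 1, T k (γ t) = t := by
    intro t ht
    rw [hTγ, min_eq_left ht.2, max_eq_right ht.1]
  have hdleft : ∀ t < T k x, γ =ᶠ[𝓝 t] fun _ => x := by
    intro t ht
    filter_upwards [Iio_mem_nhds ht] with τ hτ using hleft τ (le_of_lt hτ)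
  have hdright : ∀ t ∈ Ioo (T k x) 1, HasDerivAt γ (deriv (T k) (γ t))⁻¹ t := by
    intro t ht
    refine HasDerivAt.of_local_left_inverse hcont.continuousAt
      (hT.hasDerivAt hk (hpos t ht.2)) (hT.deriv_neg k hk _ (hpos t ht.2)).ne ?_
    filter_upwards [isOpen_Ioo.mem_nhds ht] with τ hτ using hright τ (Ioo_subset_Icc_self hτ)
  have hcontd : ∀ t < 1, ContinuousAt (fun τ => (deriv (T k) (γ τ))⁻¹) t := by
    intro t ht
    exact (ContinuousAt.comp (hT.continuousAt_deriv hk (hpos t ht))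
      hcont.continuousAt).inv₀ (hT.deriv_neg k hk _ (hpos t ht)).ne
  refine ⟨γ, ⟨hcont.continuousOn, ⟨{T k x}, ?_, ?_⟩, hmono.antitoneOn _, hleft 0 hT1.1.le,
    fun t _ => (hγ t).1⟩, hpos, hleft, ?_, ?_⟩
  · intro t ht htS
    rcases lt_or_gt_of_ne (Finset.mem_singleton.not.1 htS) with h | h
    · refine ⟨(hdleft t h).differentiableAt_iff.2 (differentiableAt_const _), ?_⟩
      rw [continuousAt_congr (hdleft t h).deriv]
      simpa using continuousAt_const
    · refine ⟨(hdright t ⟨h, ht.2⟩).differentiableAt, ?_⟩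
      refine (continuousAt_congr ?_).2 (hcontd t ht.2)
      filter_upwards [Ioo_mem_nhds h ht.2] with τ hτ using (hdright τ hτ).deriv
  · intro s hs _
    rw [Finset.mem_singleton.1 hs]
    refine ⟨⟨0, tendsto_const_nhds.congr' ?_⟩, ⟨_, Tendsto.congr' ?_
      ((hcontd (T k x) hT1.2).tendsto.mono_left nhdsWithin_le_nhds)⟩⟩
    · filter_upwards [self_mem_nhdsWithin] with τ hτ
      rw [(hdleft τ hτ).deriv_eq, deriv_const]
    · filter_upwards [Ioo_mem_nhdsGT hT1.2] with τ hτ using (hdright τ hτ).deriv.symm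
  · intro t ht
    rw [hTγ, min_eq_left ht]
    exact le_max_right _ _
  · intro t ht hne
    rcases lt_or_gt_of_ne hne with h | h
    · refine ⟨(hdleft t h).differentiableAt_iff.2 (differentiableAt_const _), Or.inl ⟨?_, ?_⟩⟩
      · rwa [hleft t h.le]
      · rw [(hdleft t h).deriv_eq, deriv_const]
    · exact ⟨(hdright t ⟨h, ht.2⟩).differentiableAt, Or.inr
        ⟨(hright t ⟨h.le, ht.2.le⟩).symm, (hdright t ⟨h, ht.2⟩).deriv⟩⟩

/-- Player I follows his `T`-strategy during the phases in which Player II has more than `k` units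
left; the phases are glued one after the other. -/
lemma exists_consumption_of_actions {a : ℝ} (ha : 0 < a) {m : ℕ} {η : ℕ → ℝ}
    (hη : IsActionVector m η) (j : ℕ) : ∀ k, k + j = m →
    ∃ β : ℝ → ℝ, IsConsumption a β ∧ (∀ t ∈ Ico (0 : ℝ) 1, 0 < β t) ∧
      (∀ i, k < i → i ≤ m → η i ≤ T i (β (η i))) ∧
      ∀ᶠ t in cofinite, t ∈ Ioo (0 : ℝ) 1 → k < remaining m η t → DifferentiableAt ℝ β t ∧
        ((t < T (remaining m η t) (β t) ∧ deriv β t = 0) ∨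
          (t = T (remaining m η t) (β t) ∧
            deriv β t = (deriv (T (remaining m η t)) (β t))⁻¹)) := by
  induction j with
  | zero =>
    intro k hk
    refine ⟨fun _ => a, isConsumption_const ha.le, fun _ _ => ha, fun i h1 h2 => by omega,
      Eventually.of_forall fun t _ h => ?_⟩
    have := remaining_le m η t
    omega
  | succ j ih =>
    intro k hkm
    obtain ⟨β, hβ, hβpos, hβT, hβf⟩ := ih (k + 1) (by omega)
    -- the phase with `k + 1` units begins at `s`
    obtain ⟨s, hs, hsη, hsT, hsm, hsn⟩ : ∃ s ∈ Icc (0 : ℝ) 1, s ≤ η (k + 1) ∧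
        s ≤ T (k + 1) (β s) ∧ (∀ i, k + 1 < i → i ≤ m → η i ≤ s) ∧
        ∀ t, 0 < t → (t ≤ s ↔ k + 1 < remaining m η t) := by
      by_cases h : k + 2 ≤ m
      · have hs := hη.mem (k + 2) (by omega) h
        exact ⟨η (k + 2), hs, hη.anti (k + 1) (by omega) h,
          (hβT (k + 2) (by omega) h).trans (hT.succ_le (by omega) (hβ.nonneg _ hs)),
          fun i h1 h2 => hη.antitone (by omega) h1 h2, fun t _ => hη.le_iff (by omega) h t⟩
      · have h0 : (0 : ℝ) ∈ Icc (0 : ℝ) 1 := left_mem_Icc.2 zero_le_one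
        refine ⟨0, h0, (hη.mem (k + 1) (by omega) (by omega)).1,
          (hT.pos (k + 1) (by omega) _ (hβ.nonneg 0 h0)).le, fun i h1 h2 => by omega, ?_⟩
        intro t ht
        have := remaining_le m η t
        exact iff_of_false (not_le.2 ht) (by omega)
    have hη1 := hη.mem (k + 1) (by omega) (by omega)
    rcases hs.2.eq_or_lt with rfl | hs1
    · refine ⟨β, hβ, hβpos, fun i hi him => ?_, ?_⟩
      · rcases Nat.lt_or_ge (k + 1) i with h | h
        · exact hβT i h him
        · obtain rfl : i = k + 1 := by omega
          rwa [le_antisymm hη1.2 hsη]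
      · filter_upwards [hβf] with t ht ht1 _ using ht ht1 ((hsn t ht1.1).1 ht1.2.le)
    · obtain ⟨γ, hγ, hγpos, hγs, hγT, hγf⟩ :=
        hT.exists_consumption (k := k + 1) (by omega) (hβpos s ⟨hs.1, hs1⟩)
      have hsγ := hγs s hsT
      refine ⟨glueAt s β γ, hβ.glueAt hγ hs hsγ, fun t ht => ?_, fun i hi him => ?_, ?_⟩
      · rcases le_or_gt t s with h | h
        · rw [glueAt_of_le h]; exact hβpos t ht
        · rw [glueAt_of_lt h]; exact hγpos t ht.2
      · rcases Nat.lt_or_ge (k + 1) i with h | h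
        · rw [glueAt_of_le (hsm i h him)]; exact hβT i h him
        · obtain rfl : i = k + 1 := by omega
          rw [glueAt_of_ge hsγ hsη]
          exact hγT _ hη1.2
      · filter_upwards [hβf, (finite_singleton s).compl_mem_cofinite,
          (finite_singleton (T (k + 1) (β s))).compl_mem_cofinite] with t ht hts htT ht1 hn
        rcases lt_or_gt_of_ne (show t ≠ s from hts) with h | h
        · have he := glueAt_eventuallyEq_left (β := β) (γ := γ) h
          rw [he.differentiableAt_iff, he.deriv_eq, he.eq_of_nhds]
          exact ht ht1 ((hsn t ht1.1).1 h.le)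
        · have he := glueAt_eventuallyEq_right (β := β) (γ := γ) h
          have hn' : remaining m η t = k + 1 := by
            have := (not_congr (hsn t ht1.1)).1 (not_le.2 h)
            omega
          rw [he.differentiableAt_iff, he.deriv_eq, he.eq_of_nhds, hn']
          exact hγf t ht1 htT

/-! ### Player II can follow a `T`-strategy -/

/-- Against a consumption function `β`, Player II acts at the first moments at which the curves
`t = T_k(β)` are reached. -/
lemma exists_actions {a : ℝ} {m : ℕ} {β : ℝ → ℝ} (hβ : IsConsumption a β) :
    ∃ η : ℕ → ℝ, IsActionVector m η ∧ (∀ k, 1 ≤ k → η k = T k (β (η k))) ∧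
      ∀ k, 1 ≤ k → ∀ t ∈ Icc 0 (η k), t ≤ T k (β t) := by
  have h0 : (0 : ℝ) ∈ Icc (0 : ℝ) 1 := left_mem_Icc.2 zero_le_one
  have h1 : (1 : ℝ) ∈ Icc (0 : ℝ) 1 := right_mem_Icc.2 zero_le_one
  have hc : ∀ k, 1 ≤ k → ContinuousOn (fun t => T k (β t)) (Icc 0 1) := fun k hk =>
    (hT.continuousOn k hk).comp hβ.continuousOn fun t ht => hβ.nonneg t ht
  have hex : ∀ k, ∃ r, 1 ≤ k → IsLeast {t ∈ Icc (0 : ℝ) 1 | T k (β t) ≤ t} r := by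
    intro k
    by_cases hk : 1 ≤ k
    · have hcl : IsClosed {t ∈ Icc (0 : ℝ) 1 | T k (β t) ≤ t} :=
        isClosed_Icc.isClosed_le (hc k hk) continuousOn_id
      obtain ⟨r, hr⟩ := (isCompact_Icc.of_isClosed_subset hcl (sep_subset _ _)).exists_isLeast
        ⟨1, h1, hT.le_one k hk _ (hβ.nonneg 1 h1)⟩
      exact ⟨r, fun _ => hr⟩
    · exact ⟨0, fun h => absurd h hk⟩
  choose η hη using hex
  have hmem : ∀ k, 1 ≤ k → η k ∈ Icc (0 : ℝ) 1 := fun k hk => (hη k hk).1.1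
  have hbefore : ∀ k, 1 ≤ k → ∀ t ∈ Ico 0 (η k), t < T k (β t) := by
    intro k hk t ht
    by_contra h
    exact absurd ((hη k hk).2 ⟨⟨ht.1, ht.2.le.trans (hmem k hk).2⟩, not_lt.1 h⟩) (not_le.2 ht.2)
  have heq : ∀ k, 1 ≤ k → η k = T k (β (η k)) := by
    intro k hk
    have hcont : ContinuousOn (fun t => t - T k (β t)) (Icc 0 (η k)) :=
      continuousOn_id.sub ((hc k hk).mono (Icc_subset_Icc_right (hmem k hk).2))
    have hz : (0 : ℝ) ∈ Icc (0 - T k (β 0)) (η k - T k (β (η k))) :=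
      ⟨by linarith [hT.pos k hk _ (hβ.nonneg 0 h0)], sub_nonneg.2 (hη k hk).1.2⟩
    obtain ⟨t, ht, h⟩ := intermediate_value_Icc (hmem k hk).1 hcont hz
    have h' : t = T k (β t) := sub_eq_zero.1 h
    rcases ht.2.eq_or_lt with rfl | hlt
    · exact h'
    · exact absurd h' (hbefore k hk t ⟨ht.1, hlt⟩).ne
  refine ⟨η, ⟨fun k hk _ => hmem k hk, fun k hk _ => ?_⟩, heq, fun k hk t ht => ?_⟩
  · exact (hη (k + 1) (by omega)).2
      ⟨hmem k hk, (hT.succ_le hk (hβ.nonneg _ (hmem k hk))).trans (heq k hk).ge⟩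
  · rcases ht.2.eq_or_lt with rfl | hlt
    · exact (heq k hk).le
    · exact (hbefore k hk t ⟨ht.1, hlt⟩).le

end IsClassT

namespace NoisyDuel

variable {D : NoisyDuel} {T : ℕ → ℝ → ℝ} {a : ℝ} {m : ℕ}

lemma isPlayableI (hT : IsClassT T) (ha : 0 < a) (hm : 1 ≤ m) {u : StrategyI}
    (hu : IsTStrategyI T u) : D.IsPlayableI a m u := by
  intro η hη
  obtain ⟨β, hβ, hβpos, -, hβf⟩ := hT.exists_consumption_of_actions ha hη m 0 (by omega)
  have hη1 := hη.mem 1 le_rfl hm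
  obtain ⟨α, hp, hα⟩ := exists_isPlay (D := D) hm hβ hη fun h => hβpos _ ⟨hη1.1, h⟩
  refine ⟨α, η, hp, ?_, fun _ _ _ _ => rfl⟩
  unfold FollowsI
  filter_upwards [hβf, (finite_singleton (η 1)).compl_mem_cofinite] with t ht hne ht1 hpos hn
  have hlt : t < η 1 := lt_of_le_of_ne ((hη.le_iff le_rfl hm t).2 hn) hne
  have he : α =ᶠ[𝓝 t] β := by
    filter_upwards [Iio_mem_nhds hlt] with τ hτ using hα τ (le_of_lt hτ)
  obtain ⟨hd, h⟩ := ht ht1 hn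
  refine ⟨he.differentiableAt_iff.2 hd, (hu t _ _ hpos hn _).2 ?_⟩
  rw [intensity, he.deriv_eq, he.eq_of_nhds]
  rcases h with ⟨h1, h2⟩ | ⟨h1, h2⟩
  · exact Or.inl ⟨h1, by rw [h2, neg_zero]⟩
  · exact Or.inr ⟨h1, by rw [h2, neg_div, one_div]⟩

/-- Against every consumption function there is a play in which Player II follows his `T`-strategy;
his action moments are the first moments at which the curves are reached. -/
lemma exists_isPlay_followsII (hT : IsClassT T) (hm : 1 ≤ m) {v : StrategyII}
    (hv : IsTStrategyII T v) {β : ℝ → ℝ} (hβ : IsConsumption a β) :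
    ∃ α η, D.IsPlay a m α η ∧ FollowsII m v α η ∧ (∀ t ≤ η 1, α t = β t) ∧
      (∀ k, 1 ≤ k → k ≤ m → η k = T k (β (η k))) ∧
      ∀ k, 1 ≤ k → ∀ t ∈ Icc 0 (η k), t ≤ T k (β t) := by
  obtain ⟨η, hη, heq, hle⟩ := hT.exists_actions (m := m) hβ
  have hmem := hη.mem 1 le_rfl hm
  obtain ⟨α, hp, hα⟩ := exists_isPlay (D := D) hm hβ hη fun h => by
    refine lt_of_le_of_ne (hβ.nonneg _ hmem) fun h0 => ?_
    have := heq 1 le_rfl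
    rw [← h0, hT.map_zero 1 le_rfl] at this
    exact h.ne this
  refine ⟨α, η, hp, ⟨fun t ht hpos hn => ?_, fun k hk hkm hpos => ?_⟩, hα,
    fun k hk _ => heq k hk, hle⟩
  · rw [hv _ _ hpos hn, hα t ((hη.le_iff le_rfl hm t).2 hn)]
    exact hle _ hn t ⟨ht.1, (hη.le_iff hn (remaining_le m η t) t).2 le_rfl⟩
  · rw [hv _ _ hpos hk, hα _ (hη.antitone le_rfl hk hkm)]
    exact heq k hk

lemma isPlayableII (hT : IsClassT T) (hm : 1 ≤ m) {v : StrategyII}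
    (hv : IsTStrategyII T v) : D.IsPlayableII a m v := by
  intro β hβ
  obtain ⟨α, η, hp, hf, hα, -⟩ := exists_isPlay_followsII (D := D) hT hm hv hβ
  exact ⟨α, η, hp, hf, fun t _ hn => hα t ((hp.actions.le_iff le_rfl hm t).2 hn)⟩

/-- When both players use `T`-strategies, one play is that in which Player II acts first whenever
the curve is reached: Player I keeps the resource `a` until Player II has used all units. -/
lemma exists_isPlay_follows (hT : IsClassT T) (ha : 0 < a) (hm : 1 ≤ m) {u : StrategyI}
    {v : StrategyII} (hu : IsTStrategyI T u) (hv : IsTStrategyII T v) :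
    ∃ α η, D.IsPlay a m α η ∧ FollowsI m u α η ∧ FollowsII m v α η := by
  obtain ⟨α, η, hp, hf, hα, heq, -⟩ :=
    exists_isPlay_followsII (D := D) (m := m) hT hm hv (isConsumption_const ha.le)
  refine ⟨α, η, hp, ?_, hf⟩
  unfold FollowsI
  filter_upwards [((Finset.Icc 1 m).image η).finite_toSet.compl_mem_cofinite] with t hne ht1 hpos hn
  have hrm := remaining_le m η t
  have hlt : ∀ k, 1 ≤ k → k ≤ remaining m η t → t < η k := by
    intro k hk hkr
    refine lt_of_le_of_ne ((hp.actions.le_iff hk (hkr.trans hrm) t).2 hkr) ?_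
    rintro rfl
    exact hne (Finset.mem_coe.2 (Finset.mem_image_of_mem η
      (Finset.mem_Icc.2 ⟨hk, hkr.trans hrm⟩)))
  have he : α =ᶠ[𝓝 t] fun _ => a := by
    filter_upwards [Iio_mem_nhds (hlt 1 le_rfl hn)] with τ hτ using hα τ (le_of_lt hτ)
  refine ⟨he.differentiableAt_iff.2 (differentiableAt_const a), (hu t _ _ hpos hn _).2 ?_⟩
  rw [intensity, he.deriv_eq, he.eq_of_nhds, deriv_const]
  have := hlt _ hn le_rfl
  rw [heq _ hn hrm] at this
  exact Or.inl ⟨this, neg_zero⟩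

/-- Following a `T`-strategy, Player I never passes the curves and spends his resource on them. -/
lemma le_and_deriv_of_followsI {u : StrategyI} (hu : IsTStrategyI T u) {α : ℝ → ℝ} {η : ℕ → ℝ}
    (h : FollowsI m u α η) : ∀ᶠ t in cofinite, t ∈ Ioo (0 : ℝ) 1 → 0 < α t →
      0 < remaining m η t →
      t ≤ T (remaining m η t) (α t) ∧ (deriv α t = 0 ∨ t = T (remaining m η t) (α t)) := by
  unfold FollowsI at h
  filter_upwards [h] with t h ht hpos hn
  rcases (hu t _ _ hpos hn _).1 (h ht hpos hn).2 with ⟨h1, h2⟩ | ⟨h1, _⟩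
  · exact ⟨h1.le, Or.inl (neg_eq_zero.1 h2)⟩
  · exact ⟨h1.le, Or.inr h1⟩

end NoisyDuel

end

theorem theorem2 (D : NoisyDuel) (a : ℝ) (ha : 0 < a) (m : ℕ) (hm : 1 ≤ m)
    (T : ℕ → ℝ → ℝ) (hT : IsClassT T)
    (heq : ∀ (x : ℝ) (k : ℕ), 0 < x → x ≤ a → 1 ≤ k → k ≤ m →
      Real.exp (∫ s in (0 : ℝ)..x, Real.log (1 - D.P₁ (T k s)))
        + ∏ i ∈ Finset.Icc 1 k, (1 - D.P₂ (T i x)) = 1) :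
    ∃ V : ℝ,
      V = D.A₁ - (D.A₁ + D.A₂) * Real.exp (∫ s in (0 : ℝ)..a, Real.log (1 - D.P₁ (T m s))) ∧
      V = (D.A₁ + D.A₂) * ∏ i ∈ Finset.Icc 1 m, (1 - D.P₂ (T i a)) - D.A₂ ∧
      (∀ α η, D.IsPlay a m α η → IsTPlay T m α η → D.payoff m α η = V) ∧
      (∀ (u : StrategyI) (v : StrategyII), IsTStrategyI T u → IsTStrategyII T v →
        D.IsSaddlePoint a m u v V) := by
  have hB : D.IsBalanced T a m := ⟨hT, heq⟩
  have hle : ∀ v, IsTStrategyII T v → ∀ α η, D.IsPlay a m α η → FollowsII m v α η →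
      D.payoff m α η ≤ (D.A₁ + D.A₂) * D.failII T m a - D.A₂ := fun v hv α η hp hf =>
    hB.payoff_le ha hm hp (fun t ht h0 hn => hv _ _ h0 hn ▸ hf.1 t ht h0 hn)
      (fun k hk hkm h0 => (hf.2 k hk hkm h0).trans (hv _ _ h0 hk))
  have hge : ∀ u, IsTStrategyI T u → ∀ α η, D.IsPlay a m α η → FollowsI m u α η →
      (D.A₁ + D.A₂) * D.failII T m a - D.A₂ ≤ D.payoff m α η := fun u hu α η hp hf =>
    hB.le_payoff ha hm hp (NoisyDuel.le_and_deriv_of_followsI hu hf)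
  refine ⟨(D.A₁ + D.A₂) * D.failII T m a - D.A₂, ?_, rfl, fun α η hp hTp => ?_,
    fun u v hu hv => ⟨NoisyDuel.isPlayableI hT ha hm hu, NoisyDuel.isPlayableII hT hm hv,
      NoisyDuel.exists_isPlay_follows hT ha hm hu hv, fun α η hp hI hII => ?_,
      fun _ α η hp _ hII => hle v hv α η hp hII, fun _ α η hp hI _ => hge u hu α η hp hI⟩⟩
  · rw [NoisyDuel.failII]
    linear_combination (D.A₁ + D.A₂) * heq a m ha le_rfl hm le_rfl
  · refine le_antisymm (hB.payoff_le ha hm hp hTp.le hTp.eqII) (hB.le_payoff ha hm hp ?_)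
    obtain ⟨S, hS⟩ := hp.consumption.piecewiseC1.exists_finset
    filter_upwards [S.finite_toSet.compl_mem_cofinite] with t htS ht h0 hn
    exact ⟨hTp.le t (Ioo_subset_Icc_self ht) h0 hn,
      hTp.deriv_eq_zero_or hp.consumption ht (hS t ht htS) h0 hn⟩
  · exact le_antisymm (hle v hv α η hp hII) (hge u hu α η hp hI)
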